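/- Let $\beta>1$ be real, let $0\le t\le \lceil\beta\rceil/\beta-1$, put $r_0=l_0=\lfloor\beta\rfloor/\beta-t$, and define $S_t:[0,1]\to[0,1]$ by $S_t(x)=\beta x-\lfloor\beta x\rfloor$ for $x\in[0,r_0)$ and $S_t(x)=\beta(x-1)+1$ for $x\in[r_0,1]$. Let $r_1$ and $l_1$ be the right and left limits of $S_t$ at $r_0$ (with $r_1=1$ if $r_0=1$, which happens only if $\beta\in\mathbb Z$), and let $r_{n+1}=S_t(r_n)$, $l_{n+1}=S_t(l_n)$ for $n\ge1$. For $n\ge 1$ put $\iota^+(n)=1$ if $r_n\ge r_0$ and $\iota^+(n)=0$ otherwise, $\iota^-(n)=1$ if $l_n\ge l_0$ and $\iota^-(n)=0$ otherwise, and for $x\in[0,1]$ $$h(x)=h_{\beta,t}(x)=C+\sum_{n\ge1,\ r_n\le x}\frac1{\beta^n}+\sum_{n\ge1,\ x<l_n}\frac1{\beta^n},\qquad C=\frac{\beta-2}{\beta-1}+\sum_{n=1}^\infty\frac{\iota^+(n)-\iota^-(n)}{\beta^n}.$$ Then the following hold. (1) For all such $\beta$ and $t$, the function $h$ is integrable and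 nonnegative Lebesgue almost everywhere, $\int_0^1h\,dx>0$, and the probability measure $\mu_t$ with density $h/\int_0^1h\,dx$ is the unique $S_t$-invariant probability measure that is absolutely continuous with respect to Lebesgue measure. It is ergodic. (2) For all such $\beta$ and $t$: there is $c>0$ with $c^{-1}<h(x)<c$ for all $x\in[0,1]$ if and only if $\beta\ge2$. Moreover, if $\beta\ge2$, then $c$ can be chosen to depend only on $\beta$. (3) For all such $\beta$ and $t$ and all $x\in[0,1]$, $$\frac{\beta-2}{\beta-1}\le h(x)\le\frac{\beta}{\beta-1}.$$ (4) Call $x\in[0,1]$ an $S_t$-generic point if $\frac1N\sum_{n=0}^{N-1}f(S_t^nx)\to\int f\,d\mu_t$ for every continuous $f:[0,1]\to\mathbb R$. Suppose that $\beta\ge2$ is not an integer and is a Pisot number, that is, a real algebraic integer greater than $1$ all of whose other Galois conjugates have modulus less than $1$. Then the family $\{S_t: 0\le t\le\lceil\beta\rceil/\beta-1\}$ has the cardinality of the continuum, and all its members are generic point equivalent to each other: $S_s$ and $S_t$ have the same set of generic points for all admissible $s,t$. -/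

import Mathlib

open MeasureTheory Set Filter Topology

noncomputable section

/-- A Pisot number: a real algebraic integer greater than one, all of whose other Galois
conjugates have modulus less than one. -/
def IsPisot (β : ℝ) : Prop :=
  IsIntegral ℤ β ∧ 1 < β ∧
    ∀ z : ℂ, Polynomial.aeval z (minpoly ℚ β) = 0 → z ≠ (β : ℂ) → ‖z‖ < 1

/-- `x` is a generic point of `T` with respect to `μ`: the time averages along the orbit of `x`
of every continuous function converge to its space average. -/
def IsGenericFor {X : Type*} [TopologicalSpace X] [MeasurableSpace X]
    (T : X → X) (μ : Measure X) (x : X) : Prop :=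
  ∀ f : C(X, ℝ),
    Tendsto (fun N : ℕ => birkhoffAverage ℝ T (fun y => f y) N x) atTop (𝓝 (∫ y, f y ∂μ))

/-- Two systems on the same space are generic point equivalent if they have the same set of
generic points. -/
def GenericPointEquivalent {X : Type*} [TopologicalSpace X] [MeasurableSpace X]
    (S : X → X) (ν : Measure X) (T : X → X) (μ : Measure X) : Prop :=
  {x | IsGenericFor S ν x} = {x | IsGenericFor T μ x}

namespace ShiftedBeta

/-- The range of the shift parameter `t`. -/
def paramSet (β : ℝ) : Set ℝ := Icc 0 ((⌈β⌉ : ℝ) / β - 1)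

/-- The formula of the map `S_t`. -/
def shiftFun (β t x : ℝ) : ℝ :=
  if x < (⌊β⌋ : ℝ) / β - t then β * x - (⌊β * x⌋ : ℝ) else β * (x - 1) + 1

theorem breakpoint_mem {β t : ℝ} (hβ : 1 < β) (ht : t ∈ paramSet β) :
    (⌊β⌋ : ℝ) / β - t ∈ unitInterval := by
  obtain ⟨h0, h1⟩ := ht
  have hpos : 0 < β := by linarith
  have hf : (⌊β⌋ : ℝ) ≤ β := Int.floor_le β
  have hc : (⌈β⌉ : ℝ) ≤ (⌊β⌋ : ℝ) + 1 := by exact_mod_cast Int.ceil_le_floor_add_one β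
  have h2 : (⌊β⌋ : ℝ) / β ≤ 1 := (div_le_one hpos).2 hf
  have h3 : (⌈β⌉ : ℝ) / β ≤ ((⌊β⌋ : ℝ) + 1) / β := by gcongr
  have h4 : ((⌊β⌋ : ℝ) + 1) / β = (⌊β⌋ : ℝ) / β + 1 / β := by ring
  have h5 : 1 / β ≤ 1 := (div_le_one hpos).2 hβ.le
  constructor <;> linarith

theorem shiftFun_mapsTo {β t : ℝ} (hβ : 1 < β) (ht : t ∈ paramSet β) :
    MapsTo (shiftFun β t) unitInterval unitInterval := by
  obtain ⟨h0, h1⟩ := ht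
  have hpos : 0 < β := by linarith
  have hc : (⌈β⌉ : ℝ) ≤ (⌊β⌋ : ℝ) + 1 := by exact_mod_cast Int.ceil_le_floor_add_one β
  rintro x ⟨hx0, hx1⟩
  unfold shiftFun
  split_ifs with h
  · have e1 := Int.floor_le (β * x)
    have e2 := (Int.lt_floor_add_one (β * x)).le
    constructor <;> linarith
  · push Not at h
    have h2 : β * ((⌊β⌋ : ℝ) / β - t) ≤ β * x := mul_le_mul_of_nonneg_left h hpos.le
    have h3 : β * t ≤ β * ((⌈β⌉ : ℝ) / β - 1) := mul_le_mul_of_nonneg_left h1 hpos.le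
    have h4 : β * ((⌊β⌋ : ℝ) / β - t) = (⌊β⌋ : ℝ) - β * t := by field_simp
    have h5 : β * ((⌈β⌉ : ℝ) / β - 1) = (⌈β⌉ : ℝ) - β := by field_simp
    constructor <;> nlinarith

variable {β : ℝ} (hβ : 1 < β) (t : paramSet β)

/-- The map `S_t : [0,1] → [0,1]`. -/
def shiftMap : unitInterval → unitInterval :=
  (shiftFun_mapsTo hβ t.2).restrict (shiftFun β t) unitInterval unitInterval

/-- The discontinuity `r₀ = l₀ = ⌊β⌋ / β - t`, as a point of `[0,1]`. -/
def breakpoint : unitInterval := ⟨(⌊β⌋ : ℝ) / β - t, breakpoint_mem hβ t.2⟩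

/-- The right orbit of the discontinuity: `r₀`, then the orbit under `S_t` of the right limit
`r₁` of `S_t` at `r₀` (if `r₀ = 1`, which happens only for an integer `β`, the right limit is
read as the value `S_t 1 = 1`). -/
def rightOrbit : ℕ → unitInterval
  | 0 => breakpoint hβ t
  | n + 1 => (shiftMap hβ t)^[n] (Function.rightLim (shiftMap hβ t) (breakpoint hβ t))

/-- The left orbit of the discontinuity: `l₀`, then the orbit under `S_t` of the left limit
`l₁` of `S_t` at `l₀`. -/
def leftOrbit : ℕ → unitInterval
  | 0 => breakpoint hβ t
  | n + 1 => (shiftMap hβ t)^[n] (Function.leftLim (shiftMap hβ t) (breakpoint hβ t))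

open Classical in
/-- `ι⁺(n)` -/
def iotaPlus (n : ℕ) : ℝ := if rightOrbit hβ t 0 ≤ rightOrbit hβ t n then 1 else 0

open Classical in
/-- `ι⁻(n)` -/
def iotaMinus (n : ℕ) : ℝ := if leftOrbit hβ t 0 ≤ leftOrbit hβ t n then 1 else 0

/-- The constant `C`; the sum is over the positive integers `n + 1`. -/
def densityConst : ℝ :=
  (β - 2) / (β - 1) +
    ∑' n : ℕ, (iotaPlus hβ t (n + 1) - iotaMinus hβ t (n + 1)) / β ^ (n + 1)

open Classical in
/-- The (not normalized) density `h`; the sums are over the positive integers `n + 1`. -/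
def density (x : unitInterval) : ℝ :=
  densityConst hβ t
    + (∑' n : ℕ, if rightOrbit hβ t (n + 1) ≤ x then 1 / β ^ (n + 1) else 0)
    + ∑' n : ℕ, if x < leftOrbit hβ t (n + 1) then 1 / β ^ (n + 1) else 0

/-- The measure whose Lebesgue density is `h` divided by its integral. -/
def densityMeasure : Measure unitInterval :=
  (volume : Measure unitInterval).withDensity
    (fun x => ENNReal.ofReal (density hβ t x / ∫ y, density hβ t y))

end ShiftedBeta

end

noncomputable section

/-! ### The breakpoint, its one-sided limits and its two orbits -/

namespace ShiftedBeta
variable {β : ℝ} (hβ : 1 < β) (t : paramSet β)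

/-! All branches of `S_t` have slope `β`. Those left of `r₀` start at height `0`, and the last one
ends at height `1`. Let `χ` be bounded with `|χ ∘ S_t - χ| ≤ ε`, and let `m a` be the integral of
`χ` over `[0,a]` minus `a` times its total integral. A change of variables gives `m a = e + m (S_t
a) / β` with `|e| ≤ ε`, so `|m| ≤ ε β / (β - 1)` (`abs_cum_sub_mul_le`): an almost invariant
function is almost constant in the weak sense.

Applied to the time averages of a bounded `ψ`, whose defect of invariance is `O(1/N)`, this shows
for every invariant density `u` that `∫ ψ u` is the limit of `∫ u` times the Lebesgue integrals of
these averages (`IsInvariantDensity.tendsto`). Thus all invariant densities are proportional and,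
when `∫ u ≠ 0`, of constant sign. Uniqueness, ergodicity and nonnegativity of `h` follow, once `h`
is known to be invariant and positive on a set of positive measure.

Invariance is checked against test functions. The integral `∫ φ h` is a discounted sum along the
orbits of `r₁` and `l₁`. Replacing `φ` by `φ ∘ S_t` shifts this sum, up to terms that the digit
expansion of a point evaluates and terms that count visits to the last branch; the latter are
cancelled by the constant `C`. The bounds on `h` hold because each `n` contributes between `0` and
`2` times `β ^ (-n)`. For `β < 2` the lower bound is useless: `h 1 = 0`, and positivity is found at
`r₁` instead.

For a Pisot number, the difference of the orbits of one point under `S_s` and `S_t` consists of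
elements of `ℤ[β]` all of whose conjugates are bounded, hence takes finitely many values
(`exists_finite_orbit_sub`). If the point is generic for `S_s`, a limit of its empirical measures
under `S_t` is therefore dominated by finitely many translates of `μ_s`. It is then absolutely
continuous, hence invariant, hence equal to `μ_t`. -/

theorem beta_mul_breakpoint :
    β * (breakpoint hβ t : ℝ) = ⌊β⌋ - β * t := by
  have : β ≠ 0 := by linarith
  simp only [breakpoint]
  field_simp

theorem beta_mul_param_nonneg (hβ : 1 < β) : 0 ≤ β * (t : ℝ) :=
  mul_nonneg (by linarith) t.2.1

theorem beta_mul_param_le (hβ : 1 < β) : β * (t : ℝ) ≤ ⌈β⌉ - β := by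
  have h : β ≠ 0 := by linarith
  have := mul_le_mul_of_nonneg_left t.2.2 (by linarith : (0 : ℝ) ≤ β)
  calc _ ≤ _ := this
    _ = _ := by field_simp

theorem beta_mul_param_lt_one (hβ : 1 < β) : β * (t : ℝ) < 1 := by
  have h1 := beta_mul_param_le t hβ
  have h2 := Int.ceil_lt_add_one β
  linarith

theorem beta_sub_one_le_mul_breakpoint : β - 1 ≤ β * (breakpoint hβ t : ℝ) := by
  have h1 := beta_mul_param_le t hβ
  have hc : (⌈β⌉ : ℝ) ≤ (⌊β⌋ : ℝ) + 1 := by exact_mod_cast Int.ceil_le_floor_add_one β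
  rw [beta_mul_breakpoint]
  linarith

theorem breakpoint_pos : (0 : ℝ) < breakpoint hβ t := by
  have h1 := beta_sub_one_le_mul_breakpoint hβ t
  by_contra! h
  nlinarith [(breakpoint hβ t).2.1]

theorem shiftMap_of_lt {x : unitInterval} (hx : x < breakpoint hβ t) :
    (shiftMap hβ t x : ℝ) = β * x - ⌊β * (x : ℝ)⌋ := by
  have : (x : ℝ) < ⌊β⌋ / β - t := hx
  change shiftFun β t x = _
  rw [shiftFun, if_pos this]

theorem shiftMap_of_ge {x : unitInterval} (hx : breakpoint hβ t ≤ x) :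
    (shiftMap hβ t x : ℝ) = β * (x - 1) + 1 := by
  have : ¬ (x : ℝ) < ⌊β⌋ / β - t := not_lt.2 hx
  change shiftFun β t x = _
  rw [shiftFun, if_neg this]

theorem measurable_shiftMap : Measurable (shiftMap hβ t) := by
  refine Measurable.subtype_mk ?_
  unfold shiftFun
  refine Measurable.ite ?_ ?_ ?_
  · exact measurableSet_lt measurable_subtype_coe measurable_const
  · have : Measurable fun x : unitInterval => β * (x : ℝ) := by fun_prop
    exact this.sub (measurable_from_top.comp (Int.measurable_floor.comp this))
  · fun_prop

theorem continuousWithinAt_shiftMap_Ici {x : unitInterval} (hx : breakpoint hβ t ≤ x) :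
    ContinuousWithinAt (shiftMap hβ t) (Ici x) x := by
  rw [ContinuousWithinAt, tendsto_subtype_rng]
  have h : Tendsto (fun y : unitInterval => β * ((y : ℝ) - 1) + 1) (𝓝[Ici x] x)
      (𝓝 (β * ((x : ℝ) - 1) + 1)) :=
    (Continuous.tendsto (by fun_prop) x).mono_left nhdsWithin_le_nhds
  rw [shiftMap_of_ge hβ t hx]
  refine h.congr' ?_
  filter_upwards [self_mem_nhdsWithin] with y hy
  exact (shiftMap_of_ge hβ t (le_trans hx hy)).symm

/-- Continuity is taken within the closed half-line, so the case `r₀ = 1`, where nothing lies to the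
right, is covered as well. -/
theorem rightLim_shiftMap :
    Function.rightLim (shiftMap hβ t) (breakpoint hβ t) = shiftMap hβ t (breakpoint hβ t) :=
  (continuousWithinAt_shiftMap_Ici hβ t le_rfl).rightLim_eq

/-- The left limit of `S_t` at the discontinuity. -/
def leftValue : unitInterval :=
  ⟨1 - β * t, by linarith [beta_mul_param_lt_one t hβ], by linarith [beta_mul_param_nonneg t hβ]⟩

theorem floor_eq_of_lt_breakpoint {x : unitInterval} (hx : x < breakpoint hβ t)
    (hx' : (⌊β⌋ : ℝ) - 1 ≤ β * x) : ⌊β * (x : ℝ)⌋ = ⌊β⌋ - 1 := by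
  have h1 := beta_mul_breakpoint hβ t
  have h2 := beta_mul_param_nonneg t hβ
  have h3 : β * (x : ℝ) < β * breakpoint hβ t := mul_lt_mul_of_pos_left hx (by linarith)
  rw [Int.floor_eq_iff]
  push_cast
  constructor <;> linarith

theorem leftLim_shiftMap :
    Function.leftLim (shiftMap hβ t) (breakpoint hβ t) = leftValue hβ t := by
  have h1 := beta_mul_breakpoint hβ t
  -- Positivity of `r₀` makes this a genuine limit rather than the default value of
  -- `Function.leftLim`.
  have hne : (𝓝[<] breakpoint hβ t).NeBot :=
    nhdsLT_neBot_of_exists_lt ⟨0, breakpoint_pos hβ t⟩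
  apply leftLim_eq_of_tendsto
  rw [tendsto_subtype_rng]
  have h : Tendsto (fun y : unitInterval => β * (y : ℝ) - (⌊β⌋ - 1)) (𝓝[<] breakpoint hβ t)
      (𝓝 (β * (breakpoint hβ t : ℝ) - (⌊β⌋ - 1))) :=
    (Continuous.tendsto (by fun_prop) _).mono_left nhdsWithin_le_nhds
  have hv : (leftValue hβ t : ℝ) = β * (breakpoint hβ t : ℝ) - (⌊β⌋ - 1) := by
    rw [h1]; simp only [leftValue]; ring
  rw [hv]
  refine h.congr' ?_
  have hcont : Continuous fun y : unitInterval => β * (y : ℝ) := by fun_prop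
  have hev : ∀ᶠ y : unitInterval in 𝓝[<] breakpoint hβ t, (⌊β⌋ : ℝ) - 1 < β * y :=
    nhdsWithin_le_nhds <| hcont.continuousAt.eventually_const_lt <| by
      linarith [beta_mul_param_lt_one t hβ]
  filter_upwards [self_mem_nhdsWithin, hev] with y hy hy'
  rw [shiftMap_of_lt hβ t hy, floor_eq_of_lt_breakpoint hβ t hy hy'.le]
  push_cast; ring

theorem rightOrbit_succ (n : ℕ) :
    rightOrbit hβ t (n + 1) = (shiftMap hβ t)^[n] (shiftMap hβ t (breakpoint hβ t)) := by
  rw [rightOrbit, rightLim_shiftMap]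

theorem leftOrbit_succ (n : ℕ) :
    leftOrbit hβ t (n + 1) = (shiftMap hβ t)^[n] (leftValue hβ t) := by
  rw [leftOrbit, leftLim_shiftMap]

theorem rightOrbit_one_val : (rightOrbit hβ t 1 : ℝ) = ⌊β⌋ + 1 - β - β * t := by
  rw [rightOrbit_succ, Function.iterate_zero_apply, shiftMap_of_ge hβ t le_rfl, mul_sub,
    beta_mul_breakpoint]
  ring

theorem leftOrbit_one_val : (leftOrbit hβ t 1 : ℝ) = 1 - β * t := by
  rw [leftOrbit_succ]; rfl

theorem iotaPlus_eq (n : ℕ) :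
    iotaPlus hβ t n = if breakpoint hβ t ≤ rightOrbit hβ t n then 1 else 0 := rfl

theorem iotaMinus_eq (n : ℕ) :
    iotaMinus hβ t n = if breakpoint hβ t ≤ leftOrbit hβ t n then 1 else 0 := rfl

end ShiftedBeta

/-! ### Bounded functions, their primitives and the change of variables along the branches -/

/-- Bounded measurable functions. -/
def BddMeasurable {X : Type*} [MeasurableSpace X] (φ : X → ℝ) : Prop :=
  Measurable φ ∧ ∃ B : ℝ, ∀ x, |φ x| ≤ B

theorem BddMeasurable.integrable {X : Type*} [MeasurableSpace X] {μ : Measure X}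
    [IsFiniteMeasure μ] {φ : X → ℝ} (h : BddMeasurable φ) : Integrable φ μ := by
  obtain ⟨B, hB⟩ := h.2
  exact Integrable.of_bound h.1.aestronglyMeasurable B (ae_of_all _ hB)

theorem BddMeasurable.mul_integrable {X : Type*} [MeasurableSpace X] {μ : Measure X}
    {φ u : X → ℝ} (h : BddMeasurable φ) (hu : Integrable u μ) :
    Integrable (fun x => φ x * u x) μ := by
  obtain ⟨B, hB⟩ := h.2
  exact hu.bdd_mul h.1.aestronglyMeasurable (ae_of_all _ hB)

theorem BddMeasurable.intervalIntegrable {φ : ℝ → ℝ} (h : BddMeasurable φ) (a b : ℝ) :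
    IntervalIntegrable φ volume a b :=
  ⟨h.integrable, h.integrable⟩

theorem BddMeasurable.comp {X Y : Type*} [MeasurableSpace X] [MeasurableSpace Y] {φ : Y → ℝ}
    (h : BddMeasurable φ) {f : X → Y} (hf : Measurable f) : BddMeasurable (φ ∘ f) := by
  obtain ⟨B, hB⟩ := h.2
  exact ⟨h.1.comp hf, B, fun x => hB _⟩

theorem BddMeasurable.indicator {X : Type*} [MeasurableSpace X] {φ : X → ℝ}
    (h : BddMeasurable φ) {s : Set X} (hs : MeasurableSet s) : BddMeasurable (s.indicator φ) := by
  obtain ⟨B, hB⟩ := h.2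
  refine ⟨h.1.indicator hs, B, fun x => le_trans ?_ (hB x)⟩
  by_cases hx : x ∈ s <;> simp [hx]

theorem bddMeasurable_const {X : Type*} [MeasurableSpace X] (c : ℝ) :
    BddMeasurable (fun _ : X => c) := ⟨measurable_const, |c|, fun _ => le_rfl⟩

/-- After substituting `y = β x`, periodicity yields `m` full periods and a remainder. Both ends of
the range of `β * a` are allowed: at `r₀` with `t = 0`, `β r₀` is an integer and the remainder must
be a full period, matching the left limit `l₁ = 1`. -/
theorem integral_comp_fract_mul {φ : ℝ → ℝ} (hφ : BddMeasurable φ) {β : ℝ} (hβ : 0 < β) {a : ℝ}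
    (m : ℤ) (h1 : (m : ℝ) ≤ β * a) (h2 : β * a ≤ m + 1) :
    ∫ x in (0 : ℝ)..a, φ (Int.fract (β * x)) =
      β⁻¹ * (m * (∫ x in (0 : ℝ)..1, φ x) + ∫ x in (0 : ℝ)..(β * a - m), φ x) := by
  have hper : Function.Periodic (fun y : ℝ => φ (Int.fract y)) 1 := fun y => by
    simp only [Int.fract_add_one]
  have hψ : BddMeasurable (fun y : ℝ => φ (Int.fract y)) := hφ.comp measurable_fract
  have key : ∀ s : ℝ, 0 ≤ s → s ≤ 1 →
      ∫ y in (0 : ℝ)..s, φ (Int.fract y) = ∫ y in (0 : ℝ)..s, φ y := by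
    intro s hs0 hs1
    refine intervalIntegral.integral_congr_Ioo_of_le hs0 fun y hy => ?_
    simp only [Int.fract_eq_self.2 ⟨hy.1.le, hy.2.trans_le hs1⟩]
  have h0 := intervalIntegral.integral_comp_mul_left (a := 0) (b := a)
    (fun y : ℝ => φ (Int.fract y)) hβ.ne'
  rw [h0, mul_zero, smul_eq_mul]
  congr 1
  rw [← intervalIntegral.integral_add_adjacent_intervals (b := (m : ℝ))
    (hψ.intervalIntegrable _ _) (hψ.intervalIntegrable _ _)]
  congr 1
  · have := hper.intervalIntegral_add_zsmul_eq m 0 fun _ _ => hψ.intervalIntegrable _ _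
    simpa [key 1 zero_le_one le_rfl] using this
  · have := intervalIntegral.integral_comp_add_right (a := 0) (b := β * a - m)
      (fun y : ℝ => φ (Int.fract y)) (m : ℝ)
    rw [zero_add, sub_add_cancel] at this
    rw [← this]
    simp only [Int.fract_add_intCast]
    exact key _ (by linarith) (by linarith)

theorem BddMeasurable.iccExtend {φ : unitInterval → ℝ} (hφ : BddMeasurable φ) :
    BddMeasurable (IccExtend (zero_le_one' ℝ) φ) :=
  hφ.comp continuous_projIcc.measurable

/-- The primitive of a function on the unit interval. -/
def cum (φ : unitInterval → ℝ) (a : ℝ) : ℝ :=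
  ∫ x in (0 : ℝ)..a, IccExtend (zero_le_one' ℝ) φ x

theorem setIntegral_Iio_eq_cum (φ : unitInterval → ℝ) (a : unitInterval) :
    ∫ x in Iio a, φ x = cum φ a := by
  have h := unitInterval.measurePreserving_coe.setIntegral_preimage_emb
    unitInterval.measurableEmbedding_coe (IccExtend (zero_le_one' ℝ) φ) (Iio (a : ℝ))
  simp only [IccExtend_val] at h
  have h1 : Iio a = (Subtype.val ⁻¹' Iio (a : ℝ) : Set unitInterval) := rfl
  have h2 : Iio (a : ℝ) ∩ unitInterval = Ico 0 (a : ℝ) := by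
    ext x
    simp only [mem_inter_iff, mem_Iio, mem_Icc, mem_Ico]
    exact ⟨fun h => ⟨h.2.1, h.1⟩, fun h => ⟨h.2, h.1, h.2.le.trans a.2.2⟩⟩
  rw [h1, h, Measure.restrict_restrict measurableSet_Iio, h2, cum,
    intervalIntegral.integral_of_le a.2.1, integral_Ico_eq_integral_Ioo,
    integral_Ioc_eq_integral_Ioo]

theorem integral_eq_cum_one (φ : unitInterval → ℝ) : ∫ x, φ x = cum φ 1 := by
  have h := setIntegral_Iio_eq_cum φ 1
  rw [← integral_Iic_eq_integral_Iio] at h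
  have : (Iic 1 : Set unitInterval) = univ := eq_univ_of_forall fun x => unitInterval.le_one'
  rwa [this, setIntegral_univ] at h

theorem setIntegral_Ici_eq_cum {φ : unitInterval → ℝ} (hφ : BddMeasurable φ) (a : unitInterval) :
    ∫ x in Ici a, φ x = cum φ 1 - cum φ a := by
  have := integral_add_compl (measurableSet_Iio (a := a)) (hφ.integrable (μ := volume))
  rw [compl_Iio, setIntegral_Iio_eq_cum, integral_eq_cum_one] at this
  linarith

theorem cum_sub_cum {φ : unitInterval → ℝ} (hφ : BddMeasurable φ) (a b : ℝ) :
    cum φ b - cum φ a = ∫ x in a..b, IccExtend (zero_le_one' ℝ) φ x :=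
  intervalIntegral.integral_interval_sub_left (hφ.iccExtend.intervalIntegrable _ _)
    (hφ.iccExtend.intervalIntegrable _ _)

theorem abs_cum_sub_cum_le {φ ψ : unitInterval → ℝ} (hφ : BddMeasurable φ) (hψ : BddMeasurable ψ)
    {ε : ℝ} (h : ∀ x, |φ x - ψ x| ≤ ε) {a b : ℝ} (hb : 0 ≤ b - a) (hb' : b - a ≤ 1) :
    |(cum φ b - cum φ a) - (cum ψ b - cum ψ a)| ≤ ε := by
  have hε : 0 ≤ ε := (abs_nonneg _).trans (h 0)
  rw [cum_sub_cum hφ, cum_sub_cum hψ, ← intervalIntegral.integral_sub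
    (hφ.iccExtend.intervalIntegrable _ _) (hψ.iccExtend.intervalIntegrable _ _)]
  have := intervalIntegral.norm_integral_le_of_norm_le_const (a := a) (b := b) (C := ε)
    (f := fun x => IccExtend (zero_le_one' ℝ) φ x - IccExtend (zero_le_one' ℝ) ψ x)
    fun x _ => h _
  rw [Real.norm_eq_abs, abs_of_nonneg hb] at this
  nlinarith

theorem cum_zero_right (φ : unitInterval → ℝ) : cum φ 0 = 0 := by simp [cum]

theorem abs_cum_le {φ : unitInterval → ℝ} (hφ : BddMeasurable φ) {B : ℝ}
    (h : ∀ x, |φ x| ≤ B) (a : unitInterval) : |cum φ a| ≤ B := by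
  have := abs_cum_sub_cum_le hφ (bddMeasurable_const 0) (ε := B) (by simpa using h)
    (a := 0) (b := a) (by simpa using a.2.1) (by simpa using a.2.2)
  simpa [cum, IccExtend, Function.comp_def] using this

namespace ShiftedBeta
variable {β : ℝ} (hβ : 1 < β) (t : paramSet β)

theorem cum_comp_shiftMap {φ : unitInterval → ℝ} (hφ : BddMeasurable φ) {a : unitInterval}
    (ha : a ≤ breakpoint hβ t) (m : ℤ) (h1 : (m : ℝ) ≤ β * a) (h2 : β * (a : ℝ) ≤ m + 1) :
    cum (φ ∘ shiftMap hβ t) a = β⁻¹ * (m * cum φ 1 + cum φ (β * a - m)) := by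
  rw [cum, cum, cum, ← integral_comp_fract_mul hφ.iccExtend (by linarith) m h1 h2]
  refine intervalIntegral.integral_congr_Ioo_of_le a.2.1 fun x hx => ?_
  have hxI : x ∈ unitInterval := ⟨hx.1.le, hx.2.le.trans a.2.2⟩
  have hlt : (⟨x, hxI⟩ : unitInterval) < breakpoint hβ t := lt_of_lt_of_le hx.2 ha
  have hS : Int.fract (β * x) = shiftMap hβ t ⟨x, hxI⟩ := (shiftMap_of_lt hβ t hlt).symm
  rw [hS, IccExtend_val, IccExtend_of_mem _ _ hxI]
  rfl

theorem cum_comp_shiftMap_of_lt {φ : unitInterval → ℝ} (hφ : BddMeasurable φ) {a : unitInterval}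
    (ha : a < breakpoint hβ t) :
    cum (φ ∘ shiftMap hβ t) a =
      β⁻¹ * (⌊β * (a : ℝ)⌋ * cum φ 1 + cum φ (shiftMap hβ t a)) := by
  rw [shiftMap_of_lt hβ t ha]
  exact cum_comp_shiftMap hβ t hφ ha.le _ (Int.floor_le _) (Int.lt_floor_add_one _).le

theorem cum_comp_shiftMap_breakpoint {φ : unitInterval → ℝ} (hφ : BddMeasurable φ) :
    cum (φ ∘ shiftMap hβ t) (breakpoint hβ t) =
      β⁻¹ * ((⌊β⌋ - 1) * cum φ 1 + cum φ (leftOrbit hβ t 1)) := by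
  have h1 := beta_mul_param_lt_one t hβ
  have h2 := beta_mul_param_nonneg t hβ
  have h3 := beta_mul_breakpoint hβ t
  -- The branch ending at `r₀` has digit `⌊β⌋ - 1`, since `⌊β⌋ - 1 < β r₀ ≤ ⌊β⌋`.
  have := cum_comp_shiftMap hβ t hφ le_rfl (⌊β⌋ - 1) (by push_cast; linarith)
    (by push_cast; linarith)
  rw [this, leftOrbit_one_val, h3]
  push_cast
  congr 3
  ring

theorem cum_comp_shiftMap_of_ge {φ : unitInterval → ℝ} (hφ : BddMeasurable φ) {a : unitInterval}
    (ha : breakpoint hβ t ≤ a) :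
    cum (φ ∘ shiftMap hβ t) 1 - cum (φ ∘ shiftMap hβ t) a =
      β⁻¹ * (cum φ 1 - cum φ (shiftMap hβ t a)) := by
  rw [cum_sub_cum (hφ.comp (measurable_shiftMap hβ t)), cum_sub_cum hφ,
    shiftMap_of_ge hβ t ha]
  have h := intervalIntegral.integral_comp_mul_add (a := (a : ℝ)) (b := 1)
    (IccExtend (zero_le_one' ℝ) φ) (by linarith : β ≠ 0) (1 - β)
  have e1 : β * ((a : ℝ) - 1) + 1 = β * a + (1 - β) := by ring
  have e2 : β * 1 + (1 - β) = (1 : ℝ) := by ring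
  rw [e2, smul_eq_mul] at h
  rw [e1]
  rw [← h]
  refine intervalIntegral.integral_congr_Ioo_of_le a.2.2 fun x hx => ?_
  have hxI : x ∈ unitInterval := ⟨a.2.1.trans hx.1.le, hx.2.le⟩
  have hge : breakpoint hβ t ≤ (⟨x, hxI⟩ : unitInterval) := le_trans ha hx.1.le
  have hS : β * x + (1 - β) = shiftMap hβ t ⟨x, hxI⟩ := by
    rw [shiftMap_of_ge hβ t hge]; ring
  rw [hS, IccExtend_val, IccExtend_of_mem _ _ hxI]
  rfl

end ShiftedBeta

/-! ### Weak convergence tested on initial intervals -/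

/-- Initial intervals form a π-system generating the Borel sets, and the uniform bound `B` lets the
limit pass through countable disjoint unions. -/
theorem tendsto_setIntegral_of_forall_Iio {ψ : ℕ → unitInterval → ℝ}
    (hψ : ∀ N, Measurable (ψ N)) {B : ℝ} (hB : ∀ N x, |ψ N x| ≤ B)
    (h1 : Tendsto (fun N => ∫ x, ψ N x) atTop (𝓝 0))
    (h : ∀ a : unitInterval, Tendsto (fun N => ∫ x in Iio a, ψ N x) atTop (𝓝 0))
    {s : Set unitInterval} (hs : MeasurableSet s) :
    Tendsto (fun N => ∫ x in s, ψ N x) atTop (𝓝 0) := by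
  have hint : ∀ N, Integrable (ψ N) := fun N => BddMeasurable.integrable ⟨hψ N, B, hB N⟩
  induction s, hs using MeasurableSpace.induction_on_inter
    (borel_eq_generateFrom_Iio unitInterval ▸ BorelSpace.measurable_eq) isPiSystem_Iio with
  | empty => simp
  | basic t ht =>
    obtain ⟨a, rfl⟩ := ht
    exact h a
  | compl t ht ih =>
    have := h1.sub ih
    rw [sub_zero] at this
    refine this.congr fun N => ?_
    rw [sub_eq_iff_eq_add', integral_add_compl ht (hint N)]
  | iUnion f hd hf ih =>
    have hsum : Summable fun i => B * volume.real (f i) := by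
      refine Summable.mul_left _ ?_
      have := measure_iUnion (μ := volume) hd hf
      refine ENNReal.summable_toReal ?_
      rw [← this]
      exact measure_ne_top _ _
    have := tendsto_tsum_of_dominated_convergence (f := fun N i => ∫ x in f i, ψ N x)
      (g := fun _ => (0 : ℝ)) hsum ih (Eventually.of_forall fun N i => by
        refine (norm_setIntegral_le_of_norm_le_const (measure_lt_top _ _) fun x _ => hB N x))
    rw [tsum_zero] at this
    refine this.congr fun N => ?_
    exact (integral_iUnion hf hd (hint N).integrableOn).symm

/-- Indicators of Borel sets span a dense subspace of `L¹`, and the functionals given by the `ψ N`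
are uniformly bounded by `B` there. -/
theorem tendsto_integral_mul_of_forall_Iio {ψ : ℕ → unitInterval → ℝ}
    (hψ : ∀ N, Measurable (ψ N)) {B : ℝ} (hB : ∀ N x, |ψ N x| ≤ B)
    (h1 : Tendsto (fun N => ∫ x, ψ N x) atTop (𝓝 0))
    (h : ∀ a : unitInterval, Tendsto (fun N => ∫ x in Iio a, ψ N x) atTop (𝓝 0))
    {u : unitInterval → ℝ} (hu : Integrable u) :
    Tendsto (fun N => ∫ x, ψ N x * u x) atTop (𝓝 0) := by
  have hbm : ∀ N, BddMeasurable (ψ N) := fun N => ⟨hψ N, B, hB N⟩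
  have hB0 : 0 ≤ B := (abs_nonneg _).trans (hB 0 0)
  refine Integrable.induction (μ := volume)
    (fun u : unitInterval → ℝ => Tendsto (fun N => ∫ x, ψ N x * u x) atTop (𝓝 0))
    ?_ ?_ ?_ ?_ hu
  · intro c s hs _
    have := (tendsto_setIntegral_of_forall_Iio hψ hB h1 h hs).mul_const c
    rw [zero_mul] at this
    refine this.congr fun N => ?_
    rw [← integral_mul_const, ← integral_indicator hs]
    congr 1 with x
    by_cases hx : x ∈ s <;> simp [hx]
  · intro f g _ hf hg ihf ihg
    have := ihf.add ihg
    rw [add_zero] at this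
    refine this.congr fun N => ?_
    rw [← integral_add ((hbm N).mul_integrable hf) ((hbm N).mul_integrable hg)]
    simp only [Pi.add_apply, mul_add]
  · refine isClosed_of_closure_subset fun f hf => ?_
    rw [mem_ofPred, Metric.tendsto_atTop]
    intro ε hε
    obtain ⟨g, hg, hfg⟩ := Metric.mem_closure_iff.1 hf (ε / (2 * (B + 1))) (by positivity)
    obtain ⟨N₀, hN₀⟩ := (Metric.tendsto_atTop.1 hg) (ε / 2) (by positivity)
    refine ⟨N₀, fun N hN => ?_⟩
    have h2 := hN₀ N hN
    rw [Real.dist_eq, sub_zero] at h2 ⊢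
    have hfi := L1.integrable_coeFn f
    have hgi := L1.integrable_coeFn g
    have h3 : |(∫ x, ψ N x * f x) - ∫ x, ψ N x * g x| ≤ B * dist f g := by
      rw [← integral_sub ((hbm N).mul_integrable hfi) ((hbm N).mul_integrable hgi),
        L1.dist_eq_integral_dist, ← integral_const_mul, ← Real.norm_eq_abs]
      refine norm_integral_le_of_norm_le ?_ (ae_of_all _ fun x => ?_)
      · exact ((hfi.sub hgi).norm.const_mul B)
      · rw [← mul_sub, norm_mul, Real.dist_eq, Real.norm_eq_abs, Real.norm_eq_abs]
        exact mul_le_mul_of_nonneg_right (hB N x) (abs_nonneg _)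
    have h4 : B * dist f g ≤ ε / 2 := by
      calc B * dist f g ≤ (B + 1) * (ε / (2 * (B + 1))) := by gcongr; linarith
        _ = ε / 2 := by field_simp
    have h5 := abs_sub_abs_le_abs_sub (∫ x, ψ N x * f x) (∫ x, ψ N x * g x)
    linarith
  · intro f g hfg _ ih
    refine ih.congr fun N => integral_congr_ae ?_
    filter_upwards [hfg] with x hx
    rw [hx]

/-! ### Almost invariant functions and proportionality of invariant densities -/

namespace ShiftedBeta
variable {β : ℝ} (hβ : 1 < β) (t : paramSet β)

/-- The expansion of `S_t` contracts the deviation `m` of the primitive from linearity by `β⁻¹` at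
each step, at the cost of an error `ε`. The supremum `M` of `|m|` thus satisfies `M ≤ ε + M / β`. -/
theorem abs_cum_sub_mul_le {χ : unitInterval → ℝ} (hχ : BddMeasurable χ) {ε : ℝ}
    (h : ∀ x, |χ (shiftMap hβ t x) - χ x| ≤ ε) (a : unitInterval) :
    |cum χ a - a * cum χ 1| ≤ ε * (β / (β - 1)) := by
  have hβ0 : 0 < β := by linarith
  set m : unitInterval → ℝ := fun a => cum χ a - a * cum χ 1 with hm
  have hS := hχ.comp (measurable_shiftMap hβ t)
  have step : ∀ a, |m a| ≤ ε + β⁻¹ * |m (shiftMap hβ t a)| := by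
    intro a
    -- Left of `r₀` the comparison of `χ` with `χ ∘ S_t` is made on `[0,a]`, where branches start at
    -- `0`; right of it on `[a,1]`, where the last branch ends at `1`.
    have key : ∃ e, |e| ≤ ε ∧ m a = e + β⁻¹ * m (shiftMap hβ t a) := by
      rcases lt_or_ge a (breakpoint hβ t) with ha | ha
      · refine ⟨_, abs_cum_sub_cum_le hχ hS (fun x => by rw [abs_sub_comm]; exact h x)
          (a := 0) (b := a) (by simpa using a.2.1) (by simpa using a.2.2), ?_⟩
        rw [cum_comp_shiftMap_of_lt hβ t hχ ha, cum_zero_right, cum_zero_right]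
        simp only [hm, shiftMap_of_lt hβ t ha]
        field_simp
        ring
      · refine ⟨_, abs_cum_sub_cum_le hS hχ h
          (a := a) (b := 1) (by linarith [a.2.2]) (by linarith [a.2.1]), ?_⟩
        rw [cum_comp_shiftMap_of_ge hβ t hχ ha]
        simp only [hm, shiftMap_of_ge hβ t ha]
        field_simp
        ring
    obtain ⟨e, he, hme⟩ := key
    rw [hme]
    refine (abs_add_le _ _).trans ?_
    rw [abs_mul, abs_of_pos (inv_pos.2 hβ0)]
    linarith
  obtain ⟨B, hB⟩ := hχ.2
  have hbdd : BddAbove (range fun a => |m a|) := by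
    refine ⟨B + B, ?_⟩
    rintro _ ⟨a, rfl⟩
    refine (abs_sub _ _).trans (add_le_add (abs_cum_le hχ hB a) ?_)
    rw [abs_mul, abs_of_nonneg a.2.1]
    have := abs_cum_le hχ hB 1
    rw [Icc.coe_one] at this
    nlinarith [a.2.1, a.2.2, abs_nonneg (cum χ 1)]
  have hM : ⨆ a, |m a| ≤ ε + β⁻¹ * ⨆ a, |m a| :=
    ciSup_le fun a => (step a).trans <| by
      gcongr
      exact le_ciSup hbdd (shiftMap hβ t a)
  refine (le_ciSup hbdd a).trans ?_
  rw [mul_div_assoc', le_div_iff₀ (by linarith)]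
  have := mul_le_mul_of_nonneg_left hM hβ0.le
  rw [mul_add, ← mul_assoc, mul_inv_cancel₀ hβ0.ne', one_mul] at this
  linarith

/-- `u` is the density of an invariant signed measure of `S_t`. -/
def IsInvariantDensity (u : unitInterval → ℝ) : Prop :=
  Integrable u ∧ ∀ φ : unitInterval → ℝ, BddMeasurable φ →
    ∫ x, φ (shiftMap hβ t x) * u x = ∫ x, φ x * u x

theorem abs_birkhoffAverage_le {X : Type*} (T : X → X) {ψ : X → ℝ} {B : ℝ}
    (hB : ∀ x, |ψ x| ≤ B) (N : ℕ) (x : X) : |birkhoffAverage ℝ T ψ N x| ≤ B := by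
  have hB0 : 0 ≤ B := (abs_nonneg _).trans (hB x)
  rcases N.eq_zero_or_pos with rfl | hN
  · simpa using hB0
  have hN' : (0 : ℝ) < N := by exact_mod_cast hN
  rw [birkhoffAverage, smul_eq_mul, abs_mul, abs_of_pos (inv_pos.2 hN'),
    inv_mul_le_iff₀ hN', birkhoffSum]
  calc _ ≤ ∑ k ∈ Finset.range N, |ψ (T^[k] x)| := Finset.abs_sum_le_sum_abs _ _
    _ ≤ ∑ k ∈ Finset.range N, B := Finset.sum_le_sum fun k _ => hB _
    _ = N * B := by simp

theorem measurable_birkhoffAverage {X : Type*} [MeasurableSpace X] {T : X → X}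
    (hT : Measurable T) {ψ : X → ℝ} (hψ : Measurable ψ) (N : ℕ) :
    Measurable (birkhoffAverage ℝ T ψ N) := by
  unfold birkhoffAverage birkhoffSum
  have : Measurable fun x => ∑ k ∈ Finset.range N, ψ (T^[k] x) :=
    Finset.measurable_sum _ fun k _ => hψ.comp (hT.iterate k)
  exact this.const_smul (N : ℝ)⁻¹

theorem IsInvariantDensity.integral_iterate {u : unitInterval → ℝ}
    (hu : IsInvariantDensity hβ t u) {ψ : unitInterval → ℝ} (hψ : BddMeasurable ψ) (k : ℕ) :
    ∫ x, ψ ((shiftMap hβ t)^[k] x) * u x = ∫ x, ψ x * u x := by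
  induction k with
  | zero => rfl
  | succ k ih =>
    rw [← ih]
    exact hu.2 _ (hψ.comp ((measurable_shiftMap hβ t).iterate k))

theorem IsInvariantDensity.integral_birkhoffAverage {u : unitInterval → ℝ}
    (hu : IsInvariantDensity hβ t u) {ψ : unitInterval → ℝ} (hψ : BddMeasurable ψ) {N : ℕ}
    (hN : N ≠ 0) :
    ∫ x, birkhoffAverage ℝ (shiftMap hβ t) ψ N x * u x = ∫ x, ψ x * u x := by
  have hN' : (N : ℝ) ≠ 0 := by exact_mod_cast hN
  simp only [birkhoffAverage, birkhoffSum, smul_eq_mul, mul_assoc, Finset.sum_mul]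
  have hint : ∀ k ∈ Finset.range N,
      Integrable fun x => ψ ((shiftMap hβ t)^[k] x) * u x := fun k _ =>
    (hψ.comp ((measurable_shiftMap hβ t).iterate k)).mul_integrable hu.1
  rw [integral_const_mul, integral_finsetSum _ hint]
  rw [Finset.sum_congr rfl fun k _ => hu.integral_iterate hβ t hψ k]
  simp [hN']

/-- The integral of `ψ` against an invariant density is the limit of the Lebesgue integrals of
the time averages of `ψ`. -/
theorem IsInvariantDensity.tendsto {u : unitInterval → ℝ} (hu : IsInvariantDensity hβ t u)
    {ψ : unitInterval → ℝ} (hψ : BddMeasurable ψ) :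
    Tendsto (fun N => (∫ x, u x) * ∫ x, birkhoffAverage ℝ (shiftMap hβ t) ψ N x) atTop
      (𝓝 (∫ x, ψ x * u x)) := by
  set A := birkhoffAverage ℝ (shiftMap hβ t) ψ with hA
  obtain ⟨B, hB⟩ := hψ.2
  have hAB : ∀ N x, |A N x| ≤ B := abs_birkhoffAverage_le _ hB
  have hAm : ∀ N, Measurable (A N) := measurable_birkhoffAverage (measurable_shiftMap hβ t) hψ.1
  have hAbm : ∀ N, BddMeasurable (A N) := fun N => ⟨hAm N, B, hAB N⟩
  have hAI : ∀ N, |∫ x, A N x| ≤ B := fun N => by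
    have := abs_cum_le (hAbm N) (hAB N) 1
    rwa [Icc.coe_one, ← integral_eq_cum_one] at this
  -- The difference telescopes to two terms, each at most `B / N`.
  have hstep : ∀ N x, |A N (shiftMap hβ t x) - A N x| ≤ (N : ℝ)⁻¹ * (B + B) := fun N x => by
    rw [hA, birkhoffAverage_apply_sub_birkhoffAverage, smul_eq_mul, abs_mul,
      abs_of_nonneg (by positivity : (0 : ℝ) ≤ (N : ℝ)⁻¹)]
    gcongr
    exact (abs_sub _ _).trans (add_le_add (hB _) (hB _))
  have key := tendsto_integral_mul_of_forall_Iio (ψ := fun N x => A N x - ∫ y, A N y)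
    (B := B + B) (fun N => (hAm N).sub_const _)
    (fun N x => (abs_sub _ _).trans (add_le_add (hAB N x) (hAI N)))
    (by
      refine tendsto_const_nhds.congr fun N => ?_
      rw [integral_sub (hAbm N).integrable (integrable_const _)]
      simp)
    (fun a => by
      have h0 : Tendsto (fun N : ℕ => (N : ℝ)⁻¹ * (B + B) * (β / (β - 1))) atTop (𝓝 0) := by
        have := (tendsto_inv_atTop_nhds_zero_nat (𝕜 := ℝ)).mul_const ((B + B) * (β / (β - 1)))
        simpa [mul_assoc] using this
      refine squeeze_zero_norm (fun N => ?_) h0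
      have := abs_cum_sub_mul_le hβ t (hAbm N) (hstep N) a
      rw [integral_sub (hAbm N).integrable.integrableOn (integrable_const _),
        setIntegral_Iio_eq_cum, setIntegral_const, integral_eq_cum_one]
      simpa [Measure.real, unitInterval.volume_Iio, a.2.1] using this) hu.1
  have h2 := key.const_sub (∫ x, ψ x * u x)
  rw [sub_zero] at h2
  refine h2.congr' ?_
  filter_upwards [eventually_ne_atTop 0] with N hN
  rw [← hu.integral_birkhoffAverage hβ t hψ hN]
  simp only [sub_mul]
  rw [integral_sub ((hAbm N).mul_integrable hu.1) (hu.1.const_mul _), integral_const_mul]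
  ring

theorem IsInvariantDensity.integral_mul_comm {u v : unitInterval → ℝ}
    (hu : IsInvariantDensity hβ t u) (hv : IsInvariantDensity hβ t v)
    {ψ : unitInterval → ℝ} (hψ : BddMeasurable ψ) :
    (∫ x, v x) * ∫ x, ψ x * u x = (∫ x, u x) * ∫ x, ψ x * v x := by
  have h1 := (hu.tendsto hβ t hψ).const_mul (∫ x, v x)
  have h2 := (hv.tendsto hβ t hψ).const_mul (∫ x, u x)
  refine tendsto_nhds_unique h1 (h2.congr fun N => ?_)
  ring

/-- The quantity is a limit of `(∫ u)²` times integrals of nonnegative averages. This forces a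
constant sign on any invariant density with nonzero integral. -/
theorem IsInvariantDensity.mul_integral_nonneg {u : unitInterval → ℝ}
    (hu : IsInvariantDensity hβ t u) {ψ : unitInterval → ℝ} (hψ : BddMeasurable ψ)
    (h0 : ∀ x, 0 ≤ ψ x) : 0 ≤ (∫ x, u x) * ∫ x, ψ x * u x := by
  refine ge_of_tendsto' ((hu.tendsto hβ t hψ).const_mul (∫ x, u x)) fun N => ?_
  rw [← mul_assoc]
  refine mul_nonneg (mul_self_nonneg _) (integral_nonneg fun x => ?_)
  simp only [birkhoffAverage, birkhoffSum, smul_eq_mul]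
  exact mul_nonneg (by positivity) (Finset.sum_nonneg fun k _ => h0 _)

end ShiftedBeta

/-! ### Digit expansions, bounds and invariance of `h` -/

theorem hasSum_one_div_pow_succ {β : ℝ} (hβ : 1 < β) :
    HasSum (fun n : ℕ => 1 / β ^ (n + 1)) (1 / (β - 1)) := by
  have h := (hasSum_geometric_of_lt_one (inv_nonneg.2 (by linarith : 0 ≤ β))
    (inv_lt_one_of_one_lt₀ hβ)).mul_left β⁻¹
  have hb : β ≠ 0 := by linarith
  have hb' : β - 1 ≠ 0 := by linarith
  have e : β⁻¹ * (1 - β⁻¹)⁻¹ = 1 / (β - 1) := by field_simp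
  rw [e] at h
  refine HasSum.congr_fun (h) fun n => ?_
  rw [pow_succ, inv_pow]
  field_simp

theorem summable_mul_one_div_pow_succ {β : ℝ} (hβ : 1 < β) {c : ℕ → ℝ} {B : ℝ}
    (hc : ∀ n, |c n| ≤ B) : Summable fun n : ℕ => 1 / β ^ (n + 1) * c n := by
  have hb : 0 < β := by linarith
  refine Summable.of_norm_bounded ((hasSum_one_div_pow_succ hβ).summable.mul_right B) fun n => ?_
  rw [norm_mul, Real.norm_of_nonneg (by positivity)]
  gcongr
  exact hc n

theorem hasSum_integral_indicator_mul {β : ℝ} (hβ : 1 < β) {φ : unitInterval → ℝ}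
    (hφ : BddMeasurable φ) {s : ℕ → Set unitInterval} (hs : ∀ n, MeasurableSet (s n)) :
    HasSum (fun n => 1 / β ^ (n + 1) * ∫ x in s n, φ x)
      (∫ x, φ x * ∑' n, (s n).indicator (fun _ => 1 / β ^ (n + 1)) x) := by
  have hb : 0 < β := by linarith
  obtain ⟨B, hB⟩ := hφ.2
  have hbound : ∀ n x, ‖(s n).indicator (fun _ => 1 / β ^ (n + 1)) x‖ ≤ 1 / β ^ (n + 1) :=
    fun n x => by
      refine (norm_indicator_le_norm_self _ _).trans ?_
      rw [Real.norm_of_nonneg (by positivity)]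
  have hsum : ∀ x, Summable fun n => (s n).indicator (fun _ => 1 / β ^ (n + 1)) x := fun x =>
    Summable.of_norm_bounded (hasSum_one_div_pow_succ hβ).summable fun n => hbound n x
  have := hasSum_integral_of_dominated_convergence (μ := volume)
    (F := fun n x => φ x * (s n).indicator (fun _ => 1 / β ^ (n + 1)) x)
    (f := fun x => φ x * ∑' n, (s n).indicator (fun _ => 1 / β ^ (n + 1)) x)
    (fun n _ => B * (1 / β ^ (n + 1)))
    (fun n => (hφ.1.mul (measurable_const.indicator (hs n))).aestronglyMeasurable)
    (fun n => ae_of_all _ fun x => by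
      rw [norm_mul]
      exact mul_le_mul (hB x) (hbound n x) (norm_nonneg _) ((abs_nonneg _).trans (hB x)))
    (ae_of_all _ fun x => (hasSum_one_div_pow_succ hβ).summable.mul_left B)
    (integrable_const _)
    (ae_of_all _ fun x => (hsum x).hasSum.mul_left _)
  refine HasSum.congr_fun (this) fun n => ?_
  rw [← integral_const_mul, ← integral_indicator (hs n)]
  congr 1 with x
  by_cases hx : x ∈ s n <;> simp [hx, mul_comm]

namespace ShiftedBeta
variable {β : ℝ} (hβ : 1 < β) (t : paramSet β)

open Classical in
/-- The digit of `x` in the expansion generated by `S_t`. -/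
def digit (x : unitInterval) : ℝ := if breakpoint hβ t ≤ x then β - 1 else ⌊β * (x : ℝ)⌋

open Classical in
/-- The indicator of the last branch of `S_t`. -/
def lastBranch (x : unitInterval) : ℝ := if breakpoint hβ t ≤ x then 1 else 0

theorem shiftMap_eq_sub_digit (x : unitInterval) :
    (shiftMap hβ t x : ℝ) = β * x - digit hβ t x := by
  unfold digit
  split_ifs with h
  · rw [shiftMap_of_ge hβ t h]; ring
  · rw [shiftMap_of_lt hβ t (not_le.1 h)]

theorem abs_digit_le (x : unitInterval) : |digit hβ t x| ≤ β := by
  have h := shiftMap_eq_sub_digit hβ t x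
  have h1 := (shiftMap hβ t x).2.1
  have h2 := (shiftMap hβ t x).2.2
  have h3 := x.2.1
  have h4 : β * x ≤ β := mul_le_of_le_one_right (by linarith) x.2.2
  have h5 : 0 ≤ β * x := mul_nonneg (by linarith) h3
  rw [abs_le]
  constructor <;> linarith

theorem abs_lastBranch_le (x : unitInterval) : |lastBranch hβ t x| ≤ 1 := by
  unfold lastBranch
  split_ifs <;> simp

/-- The expansion of a point of the unit interval generated by `S_t`. -/
theorem hasSum_digit (p : unitInterval) :
    HasSum (fun n : ℕ => 1 / β ^ (n + 1) * digit hβ t ((shiftMap hβ t)^[n] p)) p := by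
  have hb : 0 < β := by linarith
  have hs := summable_mul_one_div_pow_succ hβ
    (fun n => abs_digit_le hβ t ((shiftMap hβ t)^[n] p))
  refine (hs.hasSum_iff_tendsto_nat).2 ?_
  have h1 : ∀ N : ℕ, ∑ n ∈ Finset.range N,
      1 / β ^ (n + 1) * digit hβ t ((shiftMap hβ t)^[n] p) =
        p - ((shiftMap hβ t)^[N] p : ℝ) * β⁻¹ ^ N := by
    intro N
    induction N with
    | zero => simp
    | succ N ih =>
      rw [Finset.sum_range_succ, ih, Function.iterate_succ_apply', shiftMap_eq_sub_digit]
      rw [inv_pow, inv_pow, pow_succ]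
      field_simp
      ring
  simp only [h1]
  have h2 : Tendsto (fun N : ℕ => ((shiftMap hβ t)^[N] p : ℝ) * β⁻¹ ^ N) atTop (𝓝 0) := by
    refine squeeze_zero (fun N => mul_nonneg ((shiftMap hβ t)^[N] p).2.1 (by positivity))
      (fun N => mul_le_of_le_one_left (by positivity) ((shiftMap hβ t)^[N] p).2.2)
      (tendsto_pow_atTop_nhds_zero_of_lt_one (by positivity) (inv_lt_one_of_one_lt₀ hβ))
  simpa using h2.const_sub (p : ℝ)

/-- The discounted mass of `φ` to the right of the orbit of `p`. -/
def tailSum (φ : unitInterval → ℝ) (p : unitInterval) : ℝ :=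
  ∑' n : ℕ, 1 / β ^ (n + 1) * (cum φ 1 - cum φ ((shiftMap hβ t)^[n] p))

/-- The discounted number of visits of the orbit of `p` to the last branch. -/
def visitSum (p : unitInterval) : ℝ :=
  ∑' n : ℕ, 1 / β ^ (n + 1) * lastBranch hβ t ((shiftMap hβ t)^[n] p)

theorem summable_visitSum (p : unitInterval) :
    Summable fun n : ℕ => 1 / β ^ (n + 1) * lastBranch hβ t ((shiftMap hβ t)^[n] p) :=
  summable_mul_one_div_pow_succ hβ fun _ => abs_lastBranch_le hβ t _

theorem summable_tailSum {φ : unitInterval → ℝ} (hφ : BddMeasurable φ) (p : unitInterval) :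
    Summable fun n : ℕ => 1 / β ^ (n + 1) * (cum φ 1 - cum φ ((shiftMap hβ t)^[n] p)) := by
  obtain ⟨B, hB⟩ := hφ.2
  refine summable_mul_one_div_pow_succ hβ (B := B + B) fun n => ?_
  exact (abs_sub _ _).trans (add_le_add (abs_cum_le hφ hB 1) (abs_cum_le hφ hB _))

theorem cum_comp_shiftMap_one {φ : unitInterval → ℝ} (hφ : BddMeasurable φ) :
    cum (φ ∘ shiftMap hβ t) 1 = β⁻¹ * (⌊β⌋ * cum φ 1 + cum φ (leftOrbit hβ t 1)
      - cum φ (rightOrbit hβ t 1)) := by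
  have h1 := cum_comp_shiftMap_breakpoint hβ t hφ
  have h2 := cum_comp_shiftMap_of_ge hβ t hφ (le_refl (breakpoint hβ t))
  rw [rightOrbit_succ, Function.iterate_zero_apply]
  linear_combination h1 + h2

/-- Both branch formulas are merged into one that is affine in `lastBranch` and `digit`, so that
discounted summation along an orbit turns these two into `visitSum` and, by `hasSum_digit`, the
starting point itself. -/
theorem cum_one_sub_cum_comp_shiftMap {φ : unitInterval → ℝ} (hφ : BddMeasurable φ)
    (a : unitInterval) :
    cum (φ ∘ shiftMap hβ t) 1 - cum (φ ∘ shiftMap hβ t) a =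
      β⁻¹ * (cum φ 1 - cum φ (shiftMap hβ t a))
      + (cum (φ ∘ shiftMap hβ t) 1 - β⁻¹ * cum φ 1)
      - (cum (φ ∘ shiftMap hβ t) 1 - cum φ 1) * lastBranch hβ t a
      - β⁻¹ * cum φ 1 * digit hβ t a := by
  have hb : β ≠ 0 := by linarith
  unfold lastBranch digit
  split_ifs with h
  · rw [cum_comp_shiftMap_of_ge hβ t hφ h]
    field_simp
    ring
  · rw [cum_comp_shiftMap_of_lt hβ t hφ (not_le.1 h)]
    ring

theorem tailSum_comp_shiftMap {φ : unitInterval → ℝ} (hφ : BddMeasurable φ) (p : unitInterval) :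
    tailSum hβ t (φ ∘ shiftMap hβ t) p =
      tailSum hβ t φ p - β⁻¹ * (cum φ 1 - cum φ p)
      + (cum (φ ∘ shiftMap hβ t) 1 - β⁻¹ * cum φ 1) * (1 / (β - 1))
      - (cum (φ ∘ shiftMap hβ t) 1 - cum φ 1) * visitSum hβ t p - β⁻¹ * cum φ 1 * p := by
  have hb : β ≠ 0 := by linarith
  -- The factor `β⁻¹` together with one more iterate shifts the index of the sum by one, which loses
  -- only its first term.
  have h1 : HasSum (fun n : ℕ => 1 / β ^ (n + 1 + 1) *
      (cum φ 1 - cum φ ((shiftMap hβ t)^[n + 1] p)))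
      (tailSum hβ t φ p - β⁻¹ * (cum φ 1 - cum φ p)) := by
    have := (hasSum_nat_add_iff' (f := fun n : ℕ => 1 / β ^ (n + 1) *
      (cum φ 1 - cum φ ((shiftMap hβ t)^[n] p))) 1).2 (summable_tailSum hβ t hφ p).hasSum
    simpa [tailSum] using this
  have h2 := (hasSum_one_div_pow_succ hβ).mul_left (cum (φ ∘ shiftMap hβ t) 1 - β⁻¹ * cum φ 1)
  have h3 := (summable_visitSum hβ t p).hasSum.mul_left (cum (φ ∘ shiftMap hβ t) 1 - cum φ 1)
  have h4 := (hasSum_digit hβ t p).mul_left (β⁻¹ * cum φ 1)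
  refine HasSum.tsum_eq ?_
  refine HasSum.congr_fun ((((h1.add h2).sub h3).sub h4)) fun n => ?_
  rw [cum_one_sub_cum_comp_shiftMap hβ t hφ, ← Function.iterate_succ_apply' (shiftMap hβ t),
    pow_succ β (n + 1)]
  field_simp

theorem densityConst_eq : densityConst hβ t = (β - 2) / (β - 1)
    + (visitSum hβ t (rightOrbit hβ t 1) - visitSum hβ t (leftOrbit hβ t 1)) := by
  rw [densityConst, visitSum, visitSum, ← (summable_visitSum hβ t _).tsum_sub
    (summable_visitSum hβ t _)]
  congr 2 with n
  simp only [iotaPlus_eq, iotaMinus_eq, rightOrbit_succ, leftOrbit_succ, lastBranch,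
    Function.iterate_zero_apply]
  ring

theorem density_eq (x : unitInterval) : density hβ t x = densityConst hβ t
    + (∑' n : ℕ, (Ici (rightOrbit hβ t (n + 1))).indicator (fun _ => 1 / β ^ (n + 1)) x)
    + ∑' n : ℕ, (Iio (leftOrbit hβ t (n + 1))).indicator (fun _ => 1 / β ^ (n + 1)) x := by
  simp only [density, indicator, mem_Ici, mem_Iio]

theorem summable_indicator_one_div_pow {β : ℝ} (hβ : 1 < β) {X : Type*} (s : ℕ → Set X) (x : X) :
    Summable fun n : ℕ => (s n).indicator (fun _ => 1 / β ^ (n + 1)) x := by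
  have hb : 0 < β := by linarith
  refine Summable.of_norm_bounded (hasSum_one_div_pow_succ hβ).summable fun n => ?_
  refine (norm_indicator_le_norm_self _ _).trans ?_
  rw [Real.norm_of_nonneg (by positivity)]

theorem hasSum_density (x : unitInterval) :
    HasSum (fun n : ℕ => 1 / β ^ (n + 1) *
      (iotaPlus hβ t (n + 1) - iotaMinus hβ t (n + 1)
        + (Ici (rightOrbit hβ t (n + 1))).indicator (fun _ => 1) x
        + (Iio (leftOrbit hβ t (n + 1))).indicator (fun _ => 1) x))
      (density hβ t x - (β - 2) / (β - 1)) := by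
  have h0 : Summable fun n : ℕ => (iotaPlus hβ t (n + 1) - iotaMinus hβ t (n + 1)) / β ^ (n + 1) := by
    refine (summable_mul_one_div_pow_succ hβ
      (c := fun n => iotaPlus hβ t (n + 1) - iotaMinus hβ t (n + 1)) (B := 1) fun n => ?_).congr
      fun n => by ring
    rw [iotaPlus_eq, iotaMinus_eq]
    split_ifs <;> simp
  have := (h0.hasSum.add
    (summable_indicator_one_div_pow hβ (fun n => Ici (rightOrbit hβ t (n + 1))) x).hasSum).add
    (summable_indicator_one_div_pow hβ (fun n => Iio (leftOrbit hβ t (n + 1))) x).hasSum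
  convert this using 1
  · ext n
    simp only [indicator]
    split_ifs <;> ring
  · rw [density_eq, densityConst]
    ring

/-- The bounds hold term by term. A bracket equal to `-1` would need `x < r_n < r₀ ≤ l_n ≤ x`, and
one equal to `3` would need `r₀ ≤ r_n ≤ x < l_n < r₀`. -/
theorem density_bounds (x : unitInterval) :
    (β - 2) / (β - 1) ≤ density hβ t x ∧ density hβ t x ≤ β / (β - 1) := by
  have hb : 0 < β := by linarith
  have hb' : 0 < β - 1 := by linarith
  have h := hasSum_density hβ t x
  have hle : ∀ n : ℕ, 0 ≤ iotaPlus hβ t (n + 1) - iotaMinus hβ t (n + 1)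
        + (Ici (rightOrbit hβ t (n + 1))).indicator (fun _ => (1 : ℝ)) x
        + (Iio (leftOrbit hβ t (n + 1))).indicator (fun _ => 1) x ∧
      iotaPlus hβ t (n + 1) - iotaMinus hβ t (n + 1)
        + (Ici (rightOrbit hβ t (n + 1))).indicator (fun _ => 1) x
        + (Iio (leftOrbit hβ t (n + 1))).indicator (fun _ => 1) x ≤ 2 := by
    intro n
    rw [iotaPlus_eq, iotaMinus_eq]
    simp only [indicator, mem_Ici, mem_Iio]
    split_ifs <;> first | (constructor <;> norm_num; done) | (exfalso; order)
  constructor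
  · have := h.nonneg fun n => mul_nonneg (by positivity) (hle n).1
    linarith
  · have := hasSum_le (fun n => mul_le_mul_of_nonneg_left (hle n).2 (by positivity)) h
      ((hasSum_one_div_pow_succ hβ).mul_right 2)
    have e : β / (β - 1) = (β - 2) / (β - 1) + 1 / (β - 1) * 2 := by field_simp; ring
    linarith

theorem bddMeasurable_density : BddMeasurable (density hβ t) := by
  refine ⟨?_, |(β - 2) / (β - 1)| + |β / (β - 1)|, fun x => ?_⟩
  · have e : density hβ t = fun x => densityConst hβ t
      + (∑' n : ℕ, (Ici (rightOrbit hβ t (n + 1))).indicator (fun _ => 1 / β ^ (n + 1)) x)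
      + ∑' n : ℕ, (Iio (leftOrbit hβ t (n + 1))).indicator (fun _ => 1 / β ^ (n + 1)) x :=
      funext (density_eq hβ t)
    rw [e]
    refine (measurable_const.add ?_).add ?_
    · exact Measurable.tsum fun n => measurable_const.indicator measurableSet_Ici
    · exact Measurable.tsum fun n => measurable_const.indicator measurableSet_Iio
  · have h := density_bounds hβ t x
    have h1 := neg_abs_le ((β - 2) / (β - 1))
    have h2 := le_abs_self (β / (β - 1))
    have h3 := abs_nonneg ((β - 2) / (β - 1))
    have h4 := abs_nonneg (β / (β - 1))
    rw [abs_le]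
    constructor <;> linarith

theorem integral_mul_density {φ : unitInterval → ℝ} (hφ : BddMeasurable φ) :
    ∫ x, φ x * density hβ t x = densityConst hβ t * cum φ 1
      + tailSum hβ t φ (rightOrbit hβ t 1)
      + (cum φ 1 * (1 / (β - 1)) - tailSum hβ t φ (leftOrbit hβ t 1)) := by
  have h1 := hasSum_integral_indicator_mul hβ hφ (s := fun n => Ici (rightOrbit hβ t (n + 1)))
    fun n => measurableSet_Ici
  have h2 := hasSum_integral_indicator_mul hβ hφ (s := fun n => Iio (leftOrbit hβ t (n + 1)))
    fun n => measurableSet_Iio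
  have bm : ∀ s : ℕ → Set unitInterval, (∀ n, MeasurableSet (s n)) →
      BddMeasurable fun x => ∑' n : ℕ, (s n).indicator (fun _ => 1 / β ^ (n + 1)) x := by
    intro s hs
    refine ⟨Measurable.tsum fun n => measurable_const.indicator (hs n), 1 / (β - 1),
      fun x => ?_⟩
    have hb : 0 < β := by linarith
    rw [← Real.norm_eq_abs]
    refine tsum_of_norm_bounded (hasSum_one_div_pow_succ hβ) fun n => ?_
    refine (norm_indicator_le_norm_self _ _).trans ?_
    rw [Real.norm_of_nonneg (by positivity)]
  have i0 : Integrable fun x => φ x * densityConst hβ t := hφ.integrable.mul_const _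
  have i1 := hφ.mul_integrable (bm (fun n => Ici (rightOrbit hβ t (n + 1)))
    fun n => measurableSet_Ici).integrable (μ := volume)
  have i2 := hφ.mul_integrable (bm (fun n => Iio (leftOrbit hβ t (n + 1)))
    fun n => measurableSet_Iio).integrable (μ := volume)
  have i01 : Integrable fun x => φ x * densityConst hβ t + φ x *
      ∑' n : ℕ, (Ici (rightOrbit hβ t (n + 1))).indicator (fun _ => 1 / β ^ (n + 1)) x :=
    i0.add i1
  simp only [density_eq, mul_add]
  rw [integral_add i01 i2, integral_add i0 i1, integral_mul_const, integral_eq_cum_one,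
    ← h1.tsum_eq, ← h2.tsum_eq, tailSum, tailSum]
  have h3 := ((hasSum_one_div_pow_succ hβ).mul_left (cum φ 1)).sub
    (summable_tailSum hβ t hφ (leftOrbit hβ t 1)).hasSum
  rw [← h3.tsum_eq]
  congr 1
  · congr 1
    · ring
    · congr 1 with n
      rw [setIntegral_Ici_eq_cum hφ, rightOrbit_succ, rightOrbit_succ, Function.iterate_zero_apply]
  · congr 1 with n
    rw [setIntegral_Iio_eq_cum, leftOrbit_succ, leftOrbit_succ, Function.iterate_zero_apply]
    ring

/-- The visit sums in `C` cancel those produced by `tailSum_comp_shiftMap`. What is left vanishes by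
the formula for `∫ φ ∘ S_t` and by `r₁ - l₁ = ⌊β⌋ - β`. -/
theorem isInvariantDensity_density : IsInvariantDensity hβ t (density hβ t) := by
  refine ⟨(bddMeasurable_density hβ t).integrable, fun φ hφ => ?_⟩
  have hb : β ≠ 0 := by linarith
  have hb' : β - 1 ≠ 0 := by linarith
  have h1 := integral_mul_density hβ t hφ
  have h2 := integral_mul_density hβ t (hφ.comp (measurable_shiftMap hβ t))
  have h3 := tailSum_comp_shiftMap hβ t hφ (rightOrbit hβ t 1)
  have h4 := tailSum_comp_shiftMap hβ t hφ (leftOrbit hβ t 1)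
  have h5 := cum_comp_shiftMap_one hβ t hφ
  have h6 := densityConst_eq hβ t
  have e1 : (β - 2) / (β - 1) + 1 / (β - 1) = 1 := by field_simp; ring
  simp only [Function.comp_apply] at h2
  rw [h2, h1, h3, h4, h6]
  have e2 : (β - 2) / (β - 1) = 1 - 1 / (β - 1) := by linarith
  have e3 : β⁻¹ * β = 1 := inv_mul_cancel₀ hb
  rw [e2]
  linear_combination h5 + cum φ 1 * e3
    - β⁻¹ * cum φ 1 * (rightOrbit_one_val hβ t - leftOrbit_one_val hβ t)


/-! ### Positivity of `h` -/

theorem floor_eq_one {β : ℝ} (hβ : 1 < β) (hβ2 : β < 2) : ⌊β⌋ = 1 := by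
  rw [Int.floor_eq_iff]
  constructor <;> push_cast <;> linarith

theorem digit_eq_of_lt_two (hβ2 : β < 2) (x : unitInterval) :
    digit hβ t x = (β - 1) * lastBranch hβ t x := by
  unfold digit lastBranch
  split_ifs with h
  · ring
  · have h1 := beta_mul_breakpoint hβ t
    have h2 := beta_mul_param_nonneg t hβ
    have h3 : β * (x : ℝ) < β * breakpoint hβ t :=
      mul_lt_mul_of_pos_left (not_le.1 h) (by linarith)
    have h4 : ⌊β * (x : ℝ)⌋ = 0 := by
      rw [Int.floor_eq_zero_iff]
      rw [floor_eq_one hβ hβ2] at h1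
      push_cast at h1
      exact ⟨mul_nonneg (by linarith) x.2.1, by linarith⟩
    simp [h4]

/-- With only two branches, the digits are `0` and `β - 1`, so the digit expansion already counts
the visits to the last branch. -/
theorem visitSum_of_lt_two (hβ2 : β < 2) (p : unitInterval) :
    (β - 1) * visitSum hβ t p = p := by
  have h1 := (summable_visitSum hβ t p).hasSum.mul_left (β - 1)
  refine h1.unique ((hasSum_digit hβ t p).congr_fun fun n => ?_)
  rw [digit_eq_of_lt_two hβ t hβ2]
  ring

theorem densityConst_of_lt_two (hβ2 : β < 2) : densityConst hβ t = -(1 / (β - 1)) := by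
  have hb' : β - 1 ≠ 0 := by linarith
  have h1 := visitSum_of_lt_two hβ t hβ2 (rightOrbit hβ t 1)
  have h2 := visitSum_of_lt_two hβ t hβ2 (leftOrbit hβ t 1)
  rw [rightOrbit_one_val, floor_eq_one hβ hβ2] at h1
  rw [leftOrbit_one_val] at h2
  push_cast at h1
  rw [densityConst_eq]
  field_simp
  linear_combination h1 - h2

theorem density_one_of_lt_two (hβ2 : β < 2) : density hβ t 1 = 0 := by
  rw [density_eq, densityConst_of_lt_two hβ t hβ2]
  have h1 : ∀ n : ℕ, (Ici (rightOrbit hβ t (n + 1))).indicator (fun _ => 1 / β ^ (n + 1)) 1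
      = 1 / β ^ (n + 1) := fun n => indicator_of_mem (mem_Ici.2 unitInterval.le_one') _
  have h2 : ∀ n : ℕ, (Iio (leftOrbit hβ t (n + 1))).indicator (fun _ => 1 / β ^ (n + 1)) 1
      = 0 := fun n => indicator_of_notMem (by
        rw [mem_Iio, not_lt]; exact unitInterval.le_one') _
  simp only [h1, h2, (hasSum_one_div_pow_succ hβ).tsum_eq, tsum_zero]
  ring

theorem hasSum_density_of_lt_two (hβ2 : β < 2) (x : unitInterval) :
    HasSum (fun n : ℕ => 1 / β ^ (n + 1) *
      ((Ici (rightOrbit hβ t (n + 1))).indicator (fun _ => 1) x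
        - (Ici (leftOrbit hβ t (n + 1))).indicator (fun _ => 1) x)) (density hβ t x) := by
  have := ((summable_indicator_one_div_pow hβ
      (fun n => Ici (rightOrbit hβ t (n + 1))) x).hasSum.add
    (summable_indicator_one_div_pow hβ (fun n => Iio (leftOrbit hβ t (n + 1))) x).hasSum).sub
    (hasSum_one_div_pow_succ hβ)
  have e := density_eq hβ t x
  rw [densityConst_of_lt_two hβ t hβ2] at e
  rw [neg_add_eq_sub, sub_add_eq_add_sub] at e
  rw [e]
  refine this.congr_fun fun n => ?_
  simp only [indicator, mem_Ici, mem_Iio]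
  split_ifs <;> first | (exfalso; order) | ring

/-- None of the sets `[r_n, 1]` and `[0, l_n)` changes immediately to the right of `x`. This spreads
positivity at a point to an interval. -/
theorem continuousWithinAt_density (x : unitInterval) :
    ContinuousWithinAt (density hβ t) (Ici x) x := by
  have hb : 0 < β := by linarith
  have key : ∀ s : ℕ → Set unitInterval, (∀ n, ∀ᶠ y in 𝓝[Ici x] x, (y ∈ s n ↔ x ∈ s n)) →
      Tendsto (fun y => ∑' n : ℕ, (s n).indicator (fun _ => 1 / β ^ (n + 1)) y) (𝓝[Ici x] x)
        (𝓝 (∑' n : ℕ, (s n).indicator (fun _ => 1 / β ^ (n + 1)) x)) := by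
    intro s hs
    refine tendsto_tsum_of_dominated_convergence (hasSum_one_div_pow_succ hβ).summable
      (fun n => ?_) (Eventually.of_forall fun y n => ?_)
    · refine tendsto_const_nhds.congr' ?_
      filter_upwards [hs n] with y hy
      by_cases h : x ∈ s n <;> simp [h, hy]
    · refine (norm_indicator_le_norm_self _ _).trans ?_
      rw [Real.norm_of_nonneg (by positivity)]
  have e : density hβ t = fun x => densityConst hβ t
      + (∑' n : ℕ, (Ici (rightOrbit hβ t (n + 1))).indicator (fun _ => 1 / β ^ (n + 1)) x)
      + ∑' n : ℕ, (Iio (leftOrbit hβ t (n + 1))).indicator (fun _ => 1 / β ^ (n + 1)) x :=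
      funext (density_eq hβ t)
  have hlt : ∀ c : unitInterval, ∀ᶠ y in 𝓝[Ici x] x, (y < c ↔ x < c) := by
    intro c
    by_cases h : x < c
    · filter_upwards [nhdsWithin_le_nhds (eventually_lt_nhds h)] with y hy
      simp [h, hy]
    · filter_upwards [self_mem_nhdsWithin] with y hy
      have : ¬ y < c := not_lt.2 ((not_lt.1 h).trans hy)
      simp [h, this]
  rw [e]
  refine (tendsto_const_nhds.add (key _ fun n => ?_)).add (key _ fun n => ?_)
  · filter_upwards [hlt (rightOrbit hβ t (n + 1))] with y hy
    simp only [mem_Ici, ← not_lt, hy]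
  · exact hlt _

theorem rightOrbit_le_shiftMap (hβ2 : β < 2) {x : unitInterval} (hx : rightOrbit hβ t 1 ≤ x) :
    rightOrbit hβ t 1 ≤ shiftMap hβ t x := by
  have hr := rightOrbit_one_val hβ t
  change (rightOrbit hβ t 1 : ℝ) ≤ x at hx
  change (rightOrbit hβ t 1 : ℝ) ≤ shiftMap hβ t x
  rw [shiftMap_eq_sub_digit, digit_eq_of_lt_two hβ t hβ2, lastBranch]
  split_ifs with h
  · have h1 := beta_mul_breakpoint hβ t
    have h3 : β * (breakpoint hβ t : ℝ) ≤ β * x := mul_le_mul_of_nonneg_left h (by linarith)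
    linarith
  · have := x.2.1
    nlinarith

theorem rightOrbit_one_le_iterate (hβ2 : β < 2) {x : unitInterval} (hx : rightOrbit hβ t 1 ≤ x)
    (n : ℕ) : rightOrbit hβ t 1 ≤ (shiftMap hβ t)^[n] x := by
  induction n with
  | zero => exact hx
  | succ n ih =>
    rw [Function.iterate_succ_apply']
    exact rightOrbit_le_shiftMap hβ t hβ2 ih

theorem rightOrbit_one_lt_leftOrbit_one (hβ2 : β < 2) :
    rightOrbit hβ t 1 < leftOrbit hβ t 1 := by
  change (rightOrbit hβ t 1 : ℝ) < leftOrbit hβ t 1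
  rw [rightOrbit_one_val, leftOrbit_one_val, floor_eq_one hβ hβ2]
  push_cast
  linarith

/-- If the orbit of `q ≠ p` meets `p`, it does so with a delay, so that its discounted number of
visits to `p` is less than that of the orbit of `p`. -/
theorem tsum_visits_lt {β : ℝ} (hβ : 1 < β) {X : Type*} [DecidableEq X] (T : X → X) {p q : X} (hpq : q ≠ p) :
    ∑' n : ℕ, (if T^[n] q = p then 1 / β ^ (n + 1) else 0) <
      ∑' n : ℕ, (if T^[n] p = p then 1 / β ^ (n + 1) else 0) := by
  have hb : 0 < β := by linarith
  have hsum : ∀ x : X, Summable fun n : ℕ => (if T^[n] x = p then 1 / β ^ (n + 1) else 0) :=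
    fun x => by
      refine Summable.of_norm_bounded (hasSum_one_div_pow_succ hβ).summable fun n => ?_
      have : (0 : ℝ) ≤ 1 / β ^ (n + 1) := by positivity
      split_ifs <;> simp [abs_of_pos hb]
      positivity
  have hpos : 0 < ∑' n : ℕ, (if T^[n] p = p then 1 / β ^ (n + 1) else 0) :=
    (hsum p).tsum_pos (fun n => by positivity) 0 (by simp [hb])
  by_cases h : ∃ n, T^[n] q = p
  · obtain ⟨hm, hlt⟩ := Nat.find_spec h, fun m => @Nat.find_min _ _ h m
    set a := Nat.find h
    have ha : a ≠ 0 := by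
      intro h0
      rw [h0] at hm
      exact hpq hm
    rw [← (hsum q).sum_add_tsum_nat_add a, Finset.sum_eq_zero fun n hn =>
      if_neg (hlt n (Finset.mem_range.1 hn)), zero_add]
    have e : ∀ n : ℕ, (if T^[n + a] q = p then 1 / β ^ (n + a + 1) else 0) =
        (β ^ a)⁻¹ * (if T^[n] p = p then 1 / β ^ (n + 1) else 0) := by
      intro n
      rw [Function.iterate_add_apply, hm]
      split_ifs
      · rw [show n + a + 1 = a + (n + 1) by ring, pow_add]
        field_simp
      · simp
    simp only [e]
    rw [tsum_mul_left]
    exact mul_lt_of_lt_one_left hpos (inv_lt_one_of_one_lt₀ (one_lt_pow₀ hβ ha))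
  · push Not at h
    simpa [h] using hpos

/-- The interval `[r₁, 1]` is forward invariant and contains `l₁`, so `r_n ≤ r₁` and `l_n ≤ r₁` can
only be equalities. Hence `h r₁` is the discounted number of returns of `r₁` to itself minus that of
visits of the orbit of `l₁ ≠ r₁` to `r₁`. -/
theorem density_rightOrbit_one_pos (hβ2 : β < 2) : 0 < density hβ t (rightOrbit hβ t 1) := by
  set r := rightOrbit hβ t 1 with hr
  set l := leftOrbit hβ t 1 with hl
  have h1 : ∀ n, rightOrbit hβ t (n + 1) = (shiftMap hβ t)^[n] r := fun n => by
    rw [rightOrbit_succ, hr, rightOrbit_succ, Function.iterate_zero_apply]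
  have h2 : ∀ n, leftOrbit hβ t (n + 1) = (shiftMap hβ t)^[n] l := fun n => by
    rw [leftOrbit_succ, hl, leftOrbit_succ, Function.iterate_zero_apply]
  have hrl := rightOrbit_one_lt_leftOrbit_one hβ t hβ2
  have hsum : ∀ x : unitInterval, Summable fun n : ℕ =>
      (if (shiftMap hβ t)^[n] x = r then 1 / β ^ (n + 1) else 0) := fun x => by
    convert summable_indicator_one_div_pow hβ (fun n => (shiftMap hβ t)^[n] ⁻¹' {r}) x using 2
    simp [indicator]
  have h3 := tsum_visits_lt hβ (shiftMap hβ t) hrl.ne'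
  have h4 := ((hsum r).hasSum.sub (hsum l).hasSum).unique
    ((hasSum_density_of_lt_two hβ t hβ2 r).congr_fun fun n => ?_)
  · rw [← h4]
    exact sub_pos.2 h3
  · rw [h1, h2]
    have e1 : ∀ x : unitInterval, r ≤ x → ((shiftMap hβ t)^[n] x = r ↔
        (shiftMap hβ t)^[n] x ≤ r) := fun x hx =>
      ⟨fun h => h.le, fun h => le_antisymm h (rightOrbit_one_le_iterate hβ t hβ2 hx n)⟩
    simp only [e1 r le_rfl, e1 l hrl.le, indicator, mem_Ici]
    split_ifs <;> ring

/-- Here `t = 0` and `r₀ = 1`, and both orbits stay at the fixed point `1`; the lower bound of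
`density_bounds` degenerates to `0`. -/
theorem density_eq_one_of_eq_two (hβ2 : β = 2) (x : unitInterval) : density hβ t x = 1 := by
  subst hβ2
  have hf : ⌊(2 : ℝ)⌋ = 2 := by norm_num
  have hc : ⌈(2 : ℝ)⌉ = 2 := by norm_num
  have ht : 2 * (t : ℝ) = 0 := by
    have h1 := beta_mul_param_nonneg t hβ
    have h2 := beta_mul_param_le t hβ
    rw [hc] at h2
    push_cast at h2
    linarith
  have hr : rightOrbit hβ t 1 = 1 := Subtype.ext <| by
    rw [rightOrbit_one_val, hf, ht]; norm_num
  have hl : leftOrbit hβ t 1 = 1 := Subtype.ext <| by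
    rw [leftOrbit_one_val, ht]; norm_num
  have hS : shiftMap hβ t 1 = 1 := Subtype.ext <| by
    rw [shiftMap_of_ge hβ t unitInterval.le_one']; norm_num
  have hS' : ∀ n, (shiftMap hβ t)^[n] 1 = 1 := fun n => Function.iterate_fixed hS n
  rw [density_eq, densityConst_eq, hr, hl]
  have h1 : ∀ n, rightOrbit hβ t (n + 1) = 1 := fun n => by
    rw [rightOrbit_succ, ← hS' n, ← hr, rightOrbit_succ, Function.iterate_zero_apply]
  have h2 : ∀ n, leftOrbit hβ t (n + 1) = 1 := fun n => by
    rw [leftOrbit_succ, ← hS' n, ← hl, leftOrbit_succ, Function.iterate_zero_apply]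
  simp only [h1, h2, indicator, mem_Ici, mem_Iio]
  have hg := (hasSum_one_div_pow_succ hβ).tsum_eq
  rcases (unitInterval.le_one' (t := x)).lt_or_eq with h | h
  · simp only [h, not_le.2 h, if_true, if_false, tsum_zero, hg]
    norm_num
  · simp only [h, le_refl, lt_irrefl, if_true, if_false, tsum_zero, hg]
    norm_num

theorem volume_density_pos : 0 < volume {x | 0 < density hβ t x} := by
  rcases lt_trichotomy β 2 with h | h | h
  · have h1 : {x | 0 < density hβ t x} ∈ 𝓝[≥] (rightOrbit hβ t 1) :=
      (continuousWithinAt_density hβ t _).eventually_const_lt (density_rightOrbit_one_pos hβ t h)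
    obtain ⟨u, hu, hsub⟩ := (mem_nhdsGE_iff_exists_Ico_subset'
      (rightOrbit_one_lt_leftOrbit_one hβ t h)).1 h1
    refine lt_of_lt_of_le ?_ (measure_mono hsub)
    rw [unitInterval.volume_Ico, ENNReal.ofReal_pos]
    exact sub_pos.2 hu
  · simp [density_eq_one_of_eq_two hβ t h]
  · have : {x | 0 < density hβ t x} = univ := eq_univ_of_forall fun x =>
      (div_pos (by linarith) (by linarith)).trans_le (density_bounds hβ t x).1
    simp [this]

theorem integral_density_pos_and_nonneg :
    0 < ∫ x, density hβ t x ∧ ∀ᵐ x : unitInterval, 0 ≤ density hβ t x := by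
  have hm := (bddMeasurable_density hβ t).1
  have hinv := isInvariantDensity_density hβ t
  have hpm : MeasurableSet {x | 0 < density hβ t x} := measurableSet_lt measurable_const hm
  have hnm : MeasurableSet {x | density hβ t x < 0} := measurableSet_lt hm measurable_const
  have hψ := (bddMeasurable_const (X := unitInterval) 1).indicator hpm
  have hχ := (bddMeasurable_const (X := unitInterval) 1).indicator hnm
  have hpos : 0 < ∫ x, {x | 0 < density hβ t x}.indicator (fun _ => 1) x * density hβ t x := by
    rw [integral_pos_iff_support_of_nonneg]
    · convert volume_density_pos hβ t using 2
      ext x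
      by_cases h : 0 < density hβ t x
      · simp [h, h.ne']
      · simp [h]
    · intro x
      by_cases h : 0 < density hβ t x
      · simp [h, h.le]
      · simp [h]
    · exact hψ.mul_integrable hinv.1
  -- Testing with the indicator of `{h > 0}` gives `∫ h ≥ 0`. If `∫ h` were `0`,
  -- `IsInvariantDensity.tendsto` would make the integral of the positive part vanish.
  have hI : 0 < ∫ x, density hβ t x := by
    have h1 := hinv.mul_integral_nonneg hβ t hψ fun x => indicator_nonneg (by simp) x
    refine lt_of_le_of_ne (nonneg_of_mul_nonneg_left h1 hpos) fun h0 => hpos.ne ?_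
    have h2 := hinv.tendsto hβ t hψ
    simp only [← h0, zero_mul] at h2
    exact tendsto_nhds_unique tendsto_const_nhds h2
  refine ⟨hI, ?_⟩
  have h1 := nonneg_of_mul_nonneg_right
    (hinv.mul_integral_nonneg hβ t hχ fun x => indicator_nonneg (by simp) x) hI
  have h2 : 0 ≤ᵐ[volume] fun x =>
      -({x | density hβ t x < 0}.indicator (fun _ => 1) x * density hβ t x) :=
    ae_of_all _ fun x => by
      by_cases h : density hβ t x < 0
      · simp [h, h.le]
      · simp [h]
  have h3 := (integral_eq_zero_iff_of_nonneg_ae h2 (hχ.mul_integrable hinv.1).neg).1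
    (le_antisymm (by rw [integral_neg]; linarith) (integral_nonneg_of_ae h2))
  filter_upwards [h3] with x hx
  by_contra! h
  simp [h] at hx
  linarith


/-! ### The measure `μ_t`: ergodicity, uniqueness and two-sided bounds -/

theorem integral_density_pos : 0 < ∫ x, density hβ t x :=
  (integral_density_pos_and_nonneg hβ t).1

theorem density_nonneg_ae : ∀ᵐ x : unitInterval, 0 ≤ density hβ t x :=
  (integral_density_pos_and_nonneg hβ t).2

instance isProbabilityMeasure_densityMeasure : IsProbabilityMeasure (densityMeasure hβ t) := by
  have hI := integral_density_pos hβ t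
  have hi := (bddMeasurable_density hβ t).integrable (μ := volume)
  refine ⟨?_⟩
  rw [densityMeasure, withDensity_apply _ MeasurableSet.univ, Measure.restrict_univ,
    ← ofReal_integral_eq_lintegral_ofReal (hi.div_const _) ?_, integral_div, div_self hI.ne',
    ENNReal.ofReal_one]
  filter_upwards [density_nonneg_ae hβ t] with x hx
  exact div_nonneg hx hI.le

theorem integral_densityMeasure (φ : unitInterval → ℝ) :
    ∫ x, φ x ∂(densityMeasure hβ t) = (∫ x, density hβ t x)⁻¹ * ∫ x, φ x * density hβ t x := by
  have hI := integral_density_pos hβ t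
  have hm := (bddMeasurable_density hβ t).1
  rw [densityMeasure, integral_withDensity_eq_integral_toReal_smul
    (hm.div_const _).ennreal_ofReal (ae_of_all _ fun x => ENNReal.ofReal_lt_top),
    ← integral_const_mul]
  refine integral_congr_ae ?_
  filter_upwards [density_nonneg_ae hβ t] with x hx
  rw [ENNReal.toReal_ofReal (div_nonneg hx hI.le), smul_eq_mul]
  ring

theorem densityMeasure_real {s : Set unitInterval} (hs : MeasurableSet s) :
    (densityMeasure hβ t).real s =
      (∫ x, density hβ t x)⁻¹ * ∫ x, s.indicator (fun _ => 1) x * density hβ t x := by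
  rw [← integral_densityMeasure, integral_indicator hs]
  simp

theorem bddMeasurable_indicator_one {X : Type*} [MeasurableSpace X] {s : Set X}
    (hs : MeasurableSet s) : BddMeasurable (s.indicator fun _ => (1 : ℝ)) :=
  (bddMeasurable_const 1).indicator hs

theorem measurePreserving_shiftMap :
    MeasurePreserving (shiftMap hβ t) (densityMeasure hβ t) (densityMeasure hβ t) := by
  refine ⟨measurable_shiftMap hβ t, ?_⟩
  ext s hs
  rw [Measure.map_apply (measurable_shiftMap hβ t) hs]
  refine (measureReal_eq_measureReal_iff).1 ?_
  rw [densityMeasure_real hβ t hs, densityMeasure_real hβ t (measurable_shiftMap hβ t hs),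
    ← (isInvariantDensity_density hβ t).2 _ (bddMeasurable_indicator_one hs)]
  rfl

theorem ergodic_shiftMap : Ergodic (shiftMap hβ t) (densityMeasure hβ t) := by
  refine ⟨measurePreserving_shiftMap hβ t, ⟨fun s hs hinv => ?_⟩⟩
  have hI := integral_density_pos hβ t
  have h := isInvariantDensity_density hβ t
  have hψ := bddMeasurable_indicator_one hs
  have hmem : ∀ x, shiftMap hβ t x ∈ s ↔ x ∈ s := fun x => by
    conv_rhs => rw [← hinv]
    rfl
  have hu : IsInvariantDensity hβ t fun x => s.indicator (fun _ => 1) x * density hβ t x := by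
    refine ⟨hψ.mul_integrable h.1, fun φ hφ => ?_⟩
    have h1 := h.2 _ (hφ.indicator hs)
    convert h1 using 2
    · ext x
      by_cases hx : x ∈ s <;> simp [hx, hmem]
    · ext x
      by_cases hx : x ∈ s <;> simp [hx]
  -- Proportionality of `h` and its restriction to `s`, tested on `s`, reads `(∫ h) p = p²` for the
  -- unnormalized mass `p` of `s`; so `p` is `0` or `∫ h`.
  have h2 := hu.integral_mul_comm hβ t h hψ
  have h3 : ∀ x, s.indicator (fun _ => 1) x * (s.indicator (fun _ => 1) x * density hβ t x) =
      s.indicator (fun _ => 1) x * density hβ t x := fun x => by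
    by_cases hx : x ∈ s <;> simp [hx]
  simp only [h3] at h2
  have h4 := densityMeasure_real hβ t hs
  set p := ∫ x, s.indicator (fun _ => 1) x * density hβ t x
  rw [eventuallyConst_set]
  rcases eq_or_ne p 0 with h0 | h0
  · right
    rw [h0, mul_zero, measureReal_eq_zero_iff] at h4
    exact measure_eq_zero_iff_ae_notMem.1 h4
  · left
    rw [← mul_right_cancel₀ h0 h2, inv_mul_cancel₀ hI.ne'] at h4
    exact (mem_ae_iff_prob_eq_one hs).2 ((ENNReal.toReal_eq_one_iff _).1 h4)

/-- The Radon–Nikodym derivative of `ν` is an invariant density, hence proportional to `h`. -/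
theorem eq_densityMeasure {ν : Measure unitInterval} [IsProbabilityMeasure ν] (hν : ν ≪ volume)
    (h : MeasurePreserving (shiftMap hβ t) ν ν) : ν = densityMeasure hβ t := by
  have hI := integral_density_pos hβ t
  have hint : ∀ φ : unitInterval → ℝ,
      ∫ x, φ x * (ν.rnDeriv volume x).toReal = ∫ x, φ x ∂ν := fun φ => by
    rw [← integral_toReal_rnDeriv_mul hν]
    simp only [mul_comm]
  have hu : IsInvariantDensity hβ t fun x => (ν.rnDeriv volume x).toReal := by
    refine ⟨Measure.integrable_toReal_rnDeriv, fun φ hφ => ?_⟩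
    refine (hint fun x => φ (shiftMap hβ t x)).trans (Eq.trans ?_ (hint φ).symm)
    conv_rhs => rw [← h.map_eq]
    rw [integral_map h.measurable.aemeasurable hφ.1.aestronglyMeasurable]
  ext s hs
  refine (measureReal_eq_measureReal_iff).1 ?_
  have h1 := hu.integral_mul_comm hβ t (isInvariantDensity_density hβ t)
    (bddMeasurable_indicator_one hs)
  have h2 := hint fun _ => 1
  simp only [one_mul, integral_const, smul_eq_mul, mul_one, probReal_univ] at h2
  have h3 := hint (s.indicator fun _ => 1)
  rw [integral_indicator hs] at h3
  simp only [integral_const, smul_eq_mul, mul_one, measureReal_restrict_apply_univ] at h3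
  rw [densityMeasure_real hβ t hs, ← h3]
  rw [h2, one_mul] at h1
  rw [← h1, inv_mul_cancel_left₀ hI.ne']

theorem two_le_of_density_bounds
    (h : ∃ c : ℝ, 0 < c ∧ ∀ x : unitInterval, c⁻¹ < density hβ t x ∧ density hβ t x < c) :
    2 ≤ β := by
  by_contra! h2
  obtain ⟨c, hc, hx⟩ := h
  have := (hx 1).1
  rw [density_one_of_lt_two hβ t h2] at this
  exact this.not_ge (inv_nonneg.2 hc.le)

theorem exists_density_bounds (h2 : 2 ≤ β) :
    ∃ c : ℝ, 0 < c ∧ ∀ (t : paramSet β) (x : unitInterval),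
      c⁻¹ < density hβ t x ∧ density hβ t x < c := by
  rcases h2.eq_or_lt with h | h
  · refine ⟨2, two_pos, fun t x => ?_⟩
    rw [density_eq_one_of_eq_two hβ t h.symm]
    norm_num
  · have ha : 0 < (β - 2) / (β - 1) := div_pos (by linarith) (by linarith)
    have hb : 0 < β / (β - 1) := div_pos (by linarith) (by linarith)
    refine ⟨((β - 2) / (β - 1))⁻¹ + β / (β - 1), by positivity, fun t x => ?_⟩
    have h1 := density_bounds hβ t x
    constructor
    · refine lt_of_lt_of_le ?_ h1.1
      rw [inv_lt_comm₀ (by positivity) ha]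
      linarith
    · refine h1.2.trans_lt ?_
      have : 0 < ((β - 2) / (β - 1))⁻¹ := inv_pos.2 ha
      linarith

end ShiftedBeta

/-! ### Pisot numbers: orbits of one point under two maps differ by finitely many values -/

open IntermediateField in
/-- For a Pisot number `β`, the bounded orbits of `0` under the maps `d ↦ β d - (a + b β)` with
bounded integers `a` and `b` stay in a finite set. -/
theorem IsPisot.exists_finite_orbit {β : ℝ} (h : IsPisot β) (M : ℝ) :
    ∃ F : Set ℝ, F.Finite ∧ ∀ (a b : ℕ → ℤ) (δ : ℕ → ℝ), (∀ n, |(a n : ℝ)| ≤ M) →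
      (∀ n, |(b n : ℝ)| ≤ 1) → δ 0 = 0 → (∀ n, δ (n + 1) = β * δ n - (a n + b n * β)) →
      (∀ n, |δ n| ≤ 1) → ∀ n, δ n ∈ F := by
  obtain ⟨hint, _, hconj⟩ := h
  have hintQ : IsIntegral ℚ β := hint.tower_top
  have : FiniteDimensional ℚ ℚ⟮β⟯ := adjoin.finiteDimensional hintQ
  have : NumberField ℚ⟮β⟯ := ⟨⟩
  set α : ℚ⟮β⟯ := AdjoinSimple.gen ℚ β with hα
  have hαβ : (algebraMap ℚ⟮β⟯ ℝ) α = β := AdjoinSimple.algebraMap_gen ℚ β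
  have hαint : IsIntegral ℤ α := by
    rw [← isIntegral_algebraMap_iff (algebraMap ℚ⟮β⟯ ℝ).injective, hαβ]
    exact hint
  have hroot : ∀ φ : ℚ⟮β⟯ →+* ℂ, φ α ≠ β → ‖φ α‖ < 1 := by
    intro φ hφ
    refine hconj _ ?_ hφ
    have h1 := aeval_gen_minpoly ℚ β
    rw [Polynomial.aeval_def] at h1 ⊢
    have h2 := congrArg φ h1
    rw [Polynomial.hom_eval₂, map_zero] at h2
    rw [Subsingleton.elim (algebraMap ℚ ℂ) _]
    exact h2
  -- The quotient is the fixed point of `y ↦ ‖φ α‖ y + (M + 1)`, which bounds the orbit at a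
  -- contracting embedding. At the embedding sending `α` to `β` the bound `1` on `δ` is used
  -- instead, whence `max B 1`.
  obtain ⟨B, hB⟩ := (Set.finite_range fun φ : ℚ⟮β⟯ →+* ℂ => (M + 1) / (1 - ‖φ α‖)).bddAbove
  refine ⟨algebraMap ℚ⟮β⟯ ℝ '' {x : ℚ⟮β⟯ | IsIntegral ℤ x ∧ ∀ φ : ℚ⟮β⟯ →+* ℂ, ‖φ x‖ ≤ max B 1},
    (NumberField.Embeddings.finite_of_norm_le ℚ⟮β⟯ ℂ (max B 1)).image _, ?_⟩
  intro a b δ ha hb h0 hstep hδ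
  have hM : 0 ≤ M := (abs_nonneg _).trans (ha 0)
  -- The recursion is lifted to the number field, where all embeddings can be applied to it.
  let d : ℕ → ℚ⟮β⟯ := fun n => Nat.rec 0 (fun n x => α * x - (a n + b n * α)) n
  have hd0 : d 0 = 0 := rfl
  have hd : ∀ n, d (n + 1) = α * d n - (a n + b n * α) := fun n => rfl
  have h1 : ∀ n, algebraMap ℚ⟮β⟯ ℝ (d n) = δ n := by
    intro n
    induction n with
    | zero => rw [hd0, map_zero, h0]
    | succ n ih =>
      rw [hd, hstep, map_sub, map_mul, map_add, map_mul, ih, hαβ, map_intCast, map_intCast]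
  have h2 : ∀ n, IsIntegral ℤ (d n) := by
    intro n
    induction n with
    | zero => exact isIntegral_zero
    | succ n ih =>
      have hz : ∀ m : ℤ, IsIntegral ℤ (m : ℚ⟮β⟯) := fun m => isIntegral_algebraMap (x := m)
      exact (hαint.mul ih).sub ((hz _).add ((hz _).mul hαint))
  refine fun n => ⟨d n, ⟨h2 n, fun φ => ?_⟩, h1 n⟩
  by_cases hφ : φ α = β
  · refine le_max_of_le_right ?_
    have h3 : ∀ n, φ (d n) = (δ n : ℂ) := by
      intro n
      induction n with
      | zero => rw [hd0, map_zero, h0, Complex.ofReal_zero]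
      | succ n ih =>
        rw [hd, hstep, map_sub, map_mul, map_add, map_mul, ih, hφ, map_intCast, map_intCast]
        push_cast
        ring
    rw [h3, Complex.norm_real]
    exact hδ n
  · refine le_max_of_le_left (le_trans ?_ (hB ⟨φ, rfl⟩))
    have hz := hroot φ hφ
    have hz' : 0 < 1 - ‖φ α‖ := by linarith
    induction n with
    | zero =>
      rw [hd0, map_zero, norm_zero]
      positivity
    | succ n ih =>
      have h4 : ‖φ (d (n + 1))‖ ≤ ‖φ α‖ * ‖φ (d n)‖ + (M + 1) := by
        rw [hd, map_sub, map_mul, map_add, map_mul, map_intCast, map_intCast]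
        refine (norm_sub_le _ _).trans ?_
        rw [norm_mul]
        gcongr
        refine (norm_add_le _ _).trans ?_
        rw [norm_mul, Complex.norm_intCast, Complex.norm_intCast]
        have := mul_le_mul (hb n) hz.le (norm_nonneg _) zero_le_one
        linarith [ha n]
      have h5 : ‖φ α‖ * ‖φ (d n)‖ ≤ ‖φ α‖ * ((M + 1) / (1 - ‖φ α‖)) := by gcongr
      have h6 : ‖φ α‖ * ((M + 1) / (1 - ‖φ α‖)) + (M + 1) = (M + 1) / (1 - ‖φ α‖) := by
        field_simp
        ring
      linarith

namespace ShiftedBeta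
variable {β : ℝ} (hβ : 1 < β) (t : paramSet β)

/-- The last branch has digit `-1 + β`, the others have integer digits; so orbit differences stay in
`ℤ[β]`. -/
theorem exists_int_digit (x : unitInterval) :
    ∃ a b : ℤ, digit hβ t x = a + b * β ∧ |(a : ℝ)| ≤ β + 1 ∧ 0 ≤ b ∧ b ≤ 1 := by
  by_cases h : breakpoint hβ t ≤ x
  · refine ⟨-1, 1, ?_, ?_, zero_le_one, le_rfl⟩
    · rw [digit, if_pos h]; push_cast; ring
    · push_cast
      rw [abs_neg, abs_one]
      linarith
  · refine ⟨⌊β * (x : ℝ)⌋, 0, ?_, ?_, le_rfl, zero_le_one⟩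
    · rw [digit, if_neg h]; simp
    · have := abs_digit_le hβ t x
      rw [digit, if_neg h] at this
      linarith

/-- For a Pisot number, the orbits of a point under two maps of the family differ by elements of
a finite set. -/
theorem exists_finite_orbit_sub (hP : IsPisot β) (s t : paramSet β) :
    ∃ F : Set ℝ, F.Finite ∧ ∀ (x : unitInterval) (n : ℕ),
      ((shiftMap hβ t)^[n] x : ℝ) - (shiftMap hβ s)^[n] x ∈ F := by
  obtain ⟨F, hF, hmem⟩ := hP.exists_finite_orbit ((β + 1) + (β + 1))
  refine ⟨F, hF, fun x => ?_⟩
  choose a b hab ha hb0 hb1 using fun n => exists_int_digit hβ t ((shiftMap hβ t)^[n] x)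
  choose a' b' hab' ha' hb0' hb1' using fun n => exists_int_digit hβ s ((shiftMap hβ s)^[n] x)
  refine hmem (fun n => a n - a' n) (fun n => b n - b' n) _ (fun n => ?_) (fun n => ?_) ?_
    (fun n => ?_) fun n => ?_
  · push_cast
    exact (abs_sub _ _).trans (add_le_add (ha n) (ha' n))
  · have h1 := hb0 n
    have h2 := hb1 n
    have h3 := hb0' n
    have h4 := hb1' n
    have : |b n - b' n| ≤ 1 := by rw [abs_le]; constructor <;> linarith
    exact_mod_cast this
  · simp
  · rw [Function.iterate_succ_apply', Function.iterate_succ_apply', shiftMap_eq_sub_digit,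
      shiftMap_eq_sub_digit, hab, hab']
    push_cast
    ring
  · have h1 := ((shiftMap hβ t)^[n] x).2
    have h2 := ((shiftMap hβ s)^[n] x).2
    rw [abs_le]
    constructor <;> linarith [h1.1, h1.2, h2.1, h2.2]

/-! ### Cardinality of the family -/

theorem shiftMap_injective (hβ : 1 < β) (hne : ∀ k : ℤ, β ≠ k) :
    Function.Injective fun t : paramSet β => shiftMap hβ t := by
  intro s t hst
  by_contra hne'
  wlog hlt : breakpoint hβ t < breakpoint hβ s generalizing s t
  · refine this hst.symm (Ne.symm hne') (lt_of_le_of_ne (not_lt.1 hlt) fun h => hne' ?_)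
    have h1 : (⌊β⌋ : ℝ) / β - s = ⌊β⌋ / β - t := congrArg Subtype.val h
    exact Subtype.ext (by linarith)
  -- At the smaller breakpoint one map uses its last branch and the other the branch with digit `⌊β⌋
  -- - 1`; the two values differ by `β - ⌊β⌋`.
  have h1 := congrArg Subtype.val (congrFun hst (breakpoint hβ t))
  simp only at h1
  have h2 : (⌊β⌋ : ℝ) - 1 ≤ β * breakpoint hβ t := by
    have := beta_sub_one_le_mul_breakpoint hβ t
    linarith [Int.floor_le β]
  rw [shiftMap_of_ge hβ t le_rfl, shiftMap_of_lt hβ s hlt, floor_eq_of_lt_breakpoint hβ s hlt h2]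
    at h1
  push_cast at h1
  exact hne ⌊β⌋ (by linarith)

theorem mk_range_shiftMap (hβ : 1 < β) (hne : ∀ k : ℤ, β ≠ k) :
    Cardinal.mk (Set.range fun t : paramSet β => shiftMap hβ t) = Cardinal.continuum := by
  rw [Cardinal.mk_range_eq _ (shiftMap_injective hβ hne), paramSet]
  refine Cardinal.mk_Icc_real ?_
  have : β < ⌈β⌉ := lt_of_le_of_ne (Int.le_ceil β) (hne _)
  rw [sub_pos, one_lt_div (by linarith)]
  exact this

end ShiftedBeta

/-! ### Empirical measures, their limits and the transfer of generic points -/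

/-- The empirical measure of the first `N + 1` points of the orbit of `x`. -/
def empiricalMeasure {X : Type*} [MeasurableSpace X] (T : X → X) (x : X) (N : ℕ) :
    Measure X :=
  ((N : ENNReal) + 1)⁻¹ • ∑ n ∈ Finset.range (N + 1), Measure.dirac (T^[n] x)

instance {X : Type*} [MeasurableSpace X] (T : X → X) (x : X) (N : ℕ) :
    IsProbabilityMeasure (empiricalMeasure T x N) := by
  refine ⟨?_⟩
  have h : ((N : ENNReal) + 1) ≠ 0 := by simp
  have h' : ((N : ENNReal) + 1) ≠ ⊤ := by simp
  simp [empiricalMeasure, ENNReal.inv_mul_cancel h h']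

/-- The empirical measure as a probability measure. -/
def empiricalProbabilityMeasure {X : Type*} [MeasurableSpace X] (T : X → X) (x : X) (N : ℕ) :
    ProbabilityMeasure X := ⟨empiricalMeasure T x N, inferInstance⟩

theorem integral_empiricalMeasure {X : Type*} [MeasurableSpace X] {T : X → X} (x : X) (N : ℕ)
    {f : X → ℝ} (hf : Measurable f) :
    ∫ y, f y ∂(empiricalMeasure T x N) = birkhoffAverage ℝ T f (N + 1) x := by
  rw [empiricalMeasure, integral_smul_measure, integral_finsetSum_measure fun n _ =>
    integrable_dirac' hf.stronglyMeasurable (by simp)]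
  simp_rw [integral_dirac' f _ hf.stronglyMeasurable]
  rw [birkhoffAverage, birkhoffSum, ENNReal.toReal_inv]
  congr 2
  rw [ENNReal.toReal_add (by simp) (by simp)]
  simp

theorem frontier_preimage_subset {X Y : Type*} [TopologicalSpace X] [TopologicalSpace Y]
    (f : X → Y) (s : Set Y) :
    frontier (f ⁻¹' s) ⊆ f ⁻¹' frontier s ∪ {x | ¬ ContinuousAt f x} := by
  intro x hx
  by_cases h : ContinuousAt f x
  · left
    rw [frontier_eq_closure_inter_closure] at hx
    rw [mem_preimage, frontier_eq_closure_inter_closure]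
    exact ⟨h.continuousWithinAt.mem_closure hx.1 fun y hy => hy,
      h.continuousWithinAt.mem_closure hx.2 fun y hy => hy⟩
  · exact Or.inr h

/-- A finite measure whose integrals of nonnegative continuous functions are controlled by their
Lebesgue integrals on the line is absolutely continuous. -/
theorem absolutelyContinuous_of_integral_le {ν : Measure unitInterval} [IsFiniteMeasure ν] {K : ℝ}
    (h : ∀ f : C(ℝ, ℝ), HasCompactSupport f → (∀ x, 0 ≤ f x) →
      ∫ y : unitInterval, f y ∂ν ≤ K * ∫ x, f x) : ν ≪ volume := by
  refine Measure.AbsolutelyContinuous.mk fun A hA hA0 => ?_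
  rw [hA.measure_eq_iSup_isCompact, ENNReal.iSup_eq_zero]
  intro C
  rw [ENNReal.iSup_eq_zero]
  intro hCA
  rw [ENNReal.iSup_eq_zero]
  intro hC
  have hC0 : volume (Subtype.val '' C) = 0 := by
    rw [← unitInterval.volume_apply]
    exact measure_mono_null hCA hA0
  have hC' : IsCompact (Subtype.val '' C) := hC.image continuous_subtype_val
  rw [← measureReal_eq_zero_iff]
  refine le_antisymm (le_of_forall_pos_le_add fun ε hε => ?_) measureReal_nonneg
  -- A Urysohn function between the null compact set and a neighbourhood of small measure is tested;
  -- `|K| + 1` avoids division by zero.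
  obtain ⟨U, hCU, hU, hUε⟩ := (Subtype.val '' C).exists_isOpen_lt_of_lt
    (μ := volume) (ENNReal.ofReal (ε / (|K| + 1))) (by rw [hC0]; positivity)
  obtain ⟨f, hf1, hf0, hfc, hf01⟩ := exists_continuous_one_zero_of_isCompact hC'
    hU.isClosed_compl (disjoint_compl_right_iff_subset.2 hCU)
  have h1 : ν.real C ≤ ∫ y : unitInterval, f y ∂ν := by
    have hi : Integrable (fun y : unitInterval => f y) ν :=
      BddMeasurable.integrable ⟨(f.continuous.comp continuous_subtype_val).measurable, 1,
        fun x => by rw [abs_of_nonneg (hf01 x).1]; exact (hf01 x).2⟩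
    have e : ν.real C = ∫ y, C.indicator (fun _ => (1 : ℝ)) y ∂ν := by
      rw [integral_indicator hC.measurableSet]; simp
    rw [e]
    refine integral_mono ((integrable_const _).indicator hC.measurableSet) hi fun y => ?_
    by_cases hy : y ∈ C
    · simp only [indicator_of_mem hy]
      exact (hf1 ⟨y, hy, rfl⟩).ge
    · simp only [indicator_of_notMem hy]
      exact (hf01 _).1
  have h2 : ∫ x, f x ≤ ε / (|K| + 1) := by
    have hlt : volume U < ⊤ := hUε.trans ENNReal.ofReal_lt_top
    have e : volume.real U = ∫ y, U.indicator (fun _ => (1 : ℝ)) y := by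
      rw [integral_indicator hU.measurableSet]; simp
    have h3 : ∫ x, f x ≤ volume.real U := by
      rw [e]
      refine integral_mono (f.continuous.integrable_of_hasCompactSupport hfc)
        ((integrable_indicator_iff hU.measurableSet).2 (by simpa using hlt)) fun y => ?_
      by_cases hy : y ∈ U
      · simp only [indicator_of_mem hy]
        exact (hf01 _).2
      · simp only [indicator_of_notMem hy]
        exact (hf0 hy).le
    exact h3.trans (ENNReal.toReal_le_of_le_ofReal (by positivity) hUε.le)
  have h0 : 0 ≤ ∫ x, f x := integral_nonneg fun x => (hf01 x).1
  have h4 := h f hfc fun x => (hf01 x).1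
  have h5 : K * ∫ x, f x ≤ (|K| + 1) * (ε / (|K| + 1)) :=
    mul_le_mul ((le_abs_self K).trans (by linarith)) h2 h0 (by positivity)
  rw [mul_div_cancel₀ _ (by positivity)] at h5
  linarith

namespace ShiftedBeta
variable {β : ℝ} (hβ : 1 < β) (t : paramSet β)

theorem continuousAt_shiftMap {x : unitInterval} (hx : x ≠ breakpoint hβ t)
    (hx' : ∀ m : ℤ, β * (x : ℝ) ≠ m) : ContinuousAt (shiftMap hβ t) x := by
  rw [ContinuousAt, tendsto_subtype_rng]
  rcases lt_or_gt_of_ne hx with h | h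
  · have h1 : ContinuousAt (fun y : unitInterval => Int.fract (β * (y : ℝ))) x :=
      ContinuousAt.comp (f := fun y : unitInterval => β * (y : ℝ)) (g := Int.fract)
        (continuousAt_fract (hx' _)) (Continuous.continuousAt (by fun_prop))
    rw [shiftMap_of_lt hβ t h]
    refine h1.tendsto.congr' ?_
    filter_upwards [eventually_lt_nhds h] with y hy
    exact (shiftMap_of_lt hβ t hy).symm
  · have h1 : ContinuousAt (fun y : unitInterval => β * ((y : ℝ) - 1) + 1) x :=
      Continuous.continuousAt (by fun_prop)
    rw [shiftMap_of_ge hβ t h.le]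
    refine h1.tendsto.congr' ?_
    filter_upwards [eventually_gt_nhds h] with y hy
    exact (shiftMap_of_ge hβ t hy.le).symm

theorem countable_discontinuities : {x | ¬ ContinuousAt (shiftMap hβ t) x}.Countable := by
  have hb : β ≠ 0 := by linarith
  have h1 : (Subtype.val ⁻¹' (range fun m : ℤ => (m : ℝ) / β) : Set unitInterval).Countable :=
    (countable_range _).preimage Subtype.val_injective
  refine ((countable_singleton (breakpoint hβ t)).union h1).mono fun x hx => ?_
  by_contra hx'
  rw [mem_union, not_or] at hx'
  refine hx (continuousAt_shiftMap hβ t hx'.1 fun m hm => hx'.2 ⟨m, ?_⟩)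
  simp only
  rw [← hm, mul_div_cancel_left₀ _ hb]

theorem countable_fiber (a : unitInterval) : (shiftMap hβ t ⁻¹' {a}).Countable := by
  have hb : β ≠ 0 := by linarith
  have h1 : (Subtype.val ⁻¹' (range fun m : ℤ × ℤ => ((a : ℝ) + m.1 + m.2 * β) / β) :
      Set unitInterval).Countable := (countable_range _).preimage Subtype.val_injective
  refine h1.mono fun x hx => ?_
  obtain ⟨i, j, hij, -⟩ := exists_int_digit hβ t x
  have h2 := shiftMap_eq_sub_digit hβ t x
  rw [mem_singleton_iff.1 hx, hij] at h2
  refine ⟨(i, j), ?_⟩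
  simp only
  rw [div_eq_iff hb]
  linarith

/-- An absolutely continuous limit of empirical measures along an orbit of `S_t` is invariant. -/
theorem measurePreserving_of_tendsto_empiricalMeasure {x : unitInterval}
    {ν : ProbabilityMeasure unitInterval} {g : Filter ℕ} [g.NeBot] (hg : g ≤ atTop)
    (hν : (ν : Measure unitInterval) ≪ volume)
    (hlim : Tendsto (empiricalProbabilityMeasure (shiftMap hβ t) x) g (𝓝 ν)) :
    MeasurePreserving (shiftMap hβ t) (ν : Measure unitInterval) ν := by
  have hS := measurable_shiftMap hβ t
  refine ⟨hS, ?_⟩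
  have := Measure.isProbabilityMeasure_map (μ := (ν : Measure unitInterval)) hS.aemeasurable
  refine Measure.ext_of_Iic _ _ fun a => ?_
  rw [Measure.map_apply hS measurableSet_Iic]
  -- Absolute continuity compensates for the discontinuity of `S_t`: the frontiers of `Iic a` and of
  -- its preimage are countable, so the portmanteau theorem applies to both.
  have null : ∀ s : Set unitInterval, s.Countable → (ν : Measure unitInterval) s = 0 :=
    fun s hs => hν (hs.measure_zero _)
  have h1 := ProbabilityMeasure.tendsto_measure_of_null_frontier_of_tendsto' hlim (E := Iic a)
    (null _ ((countable_singleton a).mono (frontier_Iic_subset a)))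
  have h2 := ProbabilityMeasure.tendsto_measure_of_null_frontier_of_tendsto' hlim
    (E := shiftMap hβ t ⁻¹' Iic a) (null _ ((((countable_fiber hβ t a).mono
      (preimage_mono (frontier_Iic_subset a))).union (countable_discontinuities hβ t)).mono
        (frontier_preimage_subset _ _)))
  have h1' := (ENNReal.tendsto_toReal (measure_ne_top _ _)).comp h1
  have h2' := (ENNReal.tendsto_toReal (measure_ne_top _ _)).comp h2
  refine (measureReal_eq_measureReal_iff).1 ?_
  have hreal : ∀ (N : ℕ) (s : Set unitInterval), MeasurableSet s →
      (empiricalMeasure (shiftMap hβ t) x N s).toReal =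
        birkhoffAverage ℝ (shiftMap hβ t) (s.indicator fun _ => 1) (N + 1) x := fun N s hs => by
    rw [← integral_empiricalMeasure x N (measurable_const.indicator hs), integral_indicator hs]
    simp [Measure.real]
  have h3 : Tendsto (fun N : ℕ => ((N : ℝ) + 1)⁻¹ * 2) g (𝓝 0) := by
    have := (tendsto_one_div_add_atTop_nhds_zero_nat (𝕜 := ℝ)).mul_const 2
    simp only [one_div, zero_mul] at this
    exact this.mono_left hg
  have h4 : Tendsto (fun N => (empiricalMeasure (shiftMap hβ t) x N
      (shiftMap hβ t ⁻¹' Iic a)).toReal - (empiricalMeasure (shiftMap hβ t) x N (Iic a)).toReal)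
      g (𝓝 0) := by
    refine squeeze_zero_norm (fun N => ?_) h3
    rw [hreal N _ measurableSet_Iic, hreal N _ (hS measurableSet_Iic)]
    have e : birkhoffAverage ℝ (shiftMap hβ t)
        ((shiftMap hβ t ⁻¹' Iic a).indicator fun _ => (1 : ℝ)) (N + 1) x =
        birkhoffAverage ℝ (shiftMap hβ t) ((Iic a).indicator fun _ => 1) (N + 1)
          (shiftMap hβ t x) := by
      simp only [birkhoffAverage, birkhoffSum, ← Function.iterate_succ_apply,
        Function.iterate_succ_apply']
      rfl
    rw [e, birkhoffAverage_apply_sub_birkhoffAverage, norm_smul, Real.norm_of_nonneg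
      (by positivity)]
    push_cast
    refine mul_le_mul_of_nonneg_left ?_ (by positivity)
    have hb : ∀ y, |(Iic a).indicator (fun _ => (1 : ℝ)) y| ≤ 1 := fun y => by
      by_cases h : y ∈ Iic a
      · rw [indicator_of_mem h]; simp
      · rw [indicator_of_notMem h]; simp
    exact (abs_sub _ _).trans (by linarith [hb ((shiftMap hβ t)^[N + 1] x), hb x])
  exact sub_eq_zero.1 (tendsto_nhds_unique (h2'.sub h1') h4)

theorem integral_densityMeasure_comp_add_le {f : C(ℝ, ℝ)} (hf : HasCompactSupport f)
    (h0 : ∀ x, 0 ≤ f x) (d : ℝ) :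
    ∫ x : unitInterval, f (x + d) ∂(densityMeasure hβ t) ≤
      (∫ x, density hβ t x)⁻¹ * (β / (β - 1)) * ∫ x, f x := by
  have hI := integral_density_pos hβ t
  have hfi : Integrable f := f.continuous.integrable_of_hasCompactSupport hf
  obtain ⟨B, hB⟩ := hf.exists_bound_of_continuous f.continuous
  have hbm : BddMeasurable fun x : unitInterval => f (x + d) :=
    ⟨(f.continuous.comp (by fun_prop)).measurable, B, fun x => hB _⟩
  rw [integral_densityMeasure, mul_assoc]
  refine mul_le_mul_of_nonneg_left ?_ (inv_nonneg.2 hI.le)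
  have hK : 0 ≤ β / (β - 1) := div_nonneg (by linarith) (by linarith)
  calc ∫ x : unitInterval, f (x + d) * density hβ t x
      ≤ ∫ x : unitInterval, β / (β - 1) * f (x + d) := by
        refine integral_mono (hbm.mul_integrable (isInvariantDensity_density hβ t).1)
          (hbm.integrable.const_mul _) fun x => ?_
        simp only
        rw [mul_comm]
        exact mul_le_mul_of_nonneg_right (density_bounds hβ t x).2 (h0 _)
    _ = β / (β - 1) * ∫ x in unitInterval, f (x + d) := by
        rw [integral_const_mul]
        congr 1
        exact unitInterval.measurePreserving_coe.integral_comp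
          unitInterval.measurableEmbedding_coe fun x => f (x + d)
    _ ≤ β / (β - 1) * ∫ x, f (x + d) := by
        refine mul_le_mul_of_nonneg_left ?_ hK
        exact setIntegral_le_integral (hfi.comp_add_right d) (ae_of_all _ fun x => h0 _)
    _ = β / (β - 1) * ∫ x, f x := by rw [integral_add_right_eq_self (fun x => f x) d]

theorem isGenericFor_of_isGenericFor (hP : IsPisot β) (s t : paramSet β) {x : unitInterval}
    (hx : IsGenericFor (shiftMap hβ s) (densityMeasure hβ s) x) :
    IsGenericFor (shiftMap hβ t) (densityMeasure hβ t) x := by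
  obtain ⟨F, hF, hmem⟩ := exists_finite_orbit_sub hβ hP s t
  set e := empiricalProbabilityMeasure (shiftMap hβ t) x
  let μ : ProbabilityMeasure unitInterval := ⟨densityMeasure hβ t, inferInstance⟩
  have key : Tendsto e atTop (𝓝 μ) := by
    -- Probability measures on the unit interval form a compact space, so it suffices to identify
    -- each limit along an ultrafilter.
    rw [tendsto_iff_ultrafilter]
    intro g hg
    obtain ⟨ν, -, hν⟩ := isCompact_univ.ultrafilter_le_nhds (g.map e) (by simp)
    have hlim : Tendsto e g (𝓝 ν) := hν
    suffices h : (ν : Measure unitInterval) = densityMeasure hβ t by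
      have : ν = μ := Subtype.ext h
      rwa [← this]
    have hac : (ν : Measure unitInterval) ≪ volume := by
      refine absolutelyContinuous_of_integral_le
        (K := hF.toFinset.card * ((∫ x, density hβ s x)⁻¹ * (β / (β - 1)))) fun f hf h0 => ?_
      have h1 := (ProbabilityMeasure.tendsto_iff_forall_integral_tendsto.1 hlim)
        (BoundedContinuousFunction.mkOfCompact (f.comp ⟨Subtype.val, continuous_subtype_val⟩))
      have h2 : Tendsto (fun N => ∑ d ∈ hF.toFinset, birkhoffAverage ℝ (shiftMap hβ s)
          (fun y : unitInterval => f (y + d)) (N + 1) x) atTop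
          (𝓝 (∑ d ∈ hF.toFinset, ∫ y : unitInterval, f (y + d) ∂(densityMeasure hβ s))) := by
        refine tendsto_finsetSum _ fun d _ => ?_
        exact (hx (f.comp ⟨fun y : unitInterval => (y : ℝ) + d, by fun_prop⟩)).comp
          (tendsto_add_atTop_nat 1)
      have h3 := le_of_tendsto_of_tendsto' h1 (h2.mono_left hg) fun N => by
        have h4 := integral_empiricalMeasure (T := shiftMap hβ t) x N
          (f := fun y : unitInterval => f y)
          (f.continuous.comp continuous_subtype_val).measurable
        refine h4.le.trans ?_
        simp only [birkhoffAverage, birkhoffSum, smul_eq_mul]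
        rw [← Finset.mul_sum, Finset.sum_comm]
        refine mul_le_mul_of_nonneg_left (Finset.sum_le_sum fun n _ => ?_) (by positivity)
        -- The summand for `d = S_t^n x - S_s^n x` is `f (S_t^n x)`, and the other summands are
        -- nonnegative.
        have h5 := Finset.single_le_sum
          (f := fun d => f (((shiftMap hβ s)^[n] x : unitInterval) + d))
          (fun d _ => h0 _) (hF.mem_toFinset.2 (hmem x n))
        simpa using h5
      refine h3.trans ((Finset.sum_le_sum fun d _ =>
        integral_densityMeasure_comp_add_le hβ s hf h0 d).trans ?_)
      rw [Finset.sum_const, nsmul_eq_mul, mul_assoc, mul_assoc, mul_assoc]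
    exact eq_densityMeasure hβ t hac
      (measurePreserving_of_tendsto_empiricalMeasure hβ t hg hac hlim)
  intro f
  rw [← tendsto_add_atTop_iff_nat 1]
  have h1 := (ProbabilityMeasure.tendsto_iff_forall_integral_tendsto.1 key)
    (BoundedContinuousFunction.mkOfCompact f)
  refine h1.congr fun N => ?_
  exact integral_empiricalMeasure x N f.continuous.measurable

end ShiftedBeta

end

theorem mainTheorem4 (β : ℝ) (hβ : 1 < β) :
    -- `h` is, up to normalization, the density of the unique absolutely continuous invariant
    -- probability measure of `S_t`, and this measure is ergodic
    (∀ t : ShiftedBeta.paramSet β,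
      Integrable (ShiftedBeta.density hβ t) ∧
      (∀ᵐ x : unitInterval, 0 ≤ ShiftedBeta.density hβ t x) ∧
      0 < ∫ x, ShiftedBeta.density hβ t x ∧
      IsProbabilityMeasure (ShiftedBeta.densityMeasure hβ t) ∧
      Ergodic (ShiftedBeta.shiftMap hβ t) (ShiftedBeta.densityMeasure hβ t) ∧
      ∀ ν : Measure unitInterval, IsProbabilityMeasure ν → ν ≪ volume →
        MeasurePreserving (ShiftedBeta.shiftMap hβ t) ν ν →
        ν = ShiftedBeta.densityMeasure hβ t) ∧
    -- `h` is bounded above and away from zero if and only if `2 ≤ β`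
    (∀ t : ShiftedBeta.paramSet β,
      (∃ c : ℝ, 0 < c ∧ ∀ x : unitInterval,
        c⁻¹ < ShiftedBeta.density hβ t x ∧ ShiftedBeta.density hβ t x < c) ↔ 2 ≤ β) ∧
    -- the constant can be chosen to depend on `β` only
    (2 ≤ β → ∃ c : ℝ, 0 < c ∧ ∀ (t : ShiftedBeta.paramSet β) (x : unitInterval),
      c⁻¹ < ShiftedBeta.density hβ t x ∧ ShiftedBeta.density hβ t x < c) ∧
    -- the explicit bounds
    (∀ (t : ShiftedBeta.paramSet β) (x : unitInterval),
      (β - 2) / (β - 1) ≤ ShiftedBeta.density hβ t x ∧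
      ShiftedBeta.density hβ t x ≤ β / (β - 1)) ∧
    -- generic point equivalence of the whole family, which has the cardinality of the continuum
    (IsPisot β → 2 ≤ β → (∀ k : ℤ, β ≠ k) →
      Cardinal.mk (Set.range (fun t : ShiftedBeta.paramSet β => ShiftedBeta.shiftMap hβ t))
        = Cardinal.continuum ∧
      ∀ s t : ShiftedBeta.paramSet β,
        GenericPointEquivalent
          (ShiftedBeta.shiftMap hβ s) (ShiftedBeta.densityMeasure hβ s)
          (ShiftedBeta.shiftMap hβ t) (ShiftedBeta.densityMeasure hβ t)) := by
  refine ⟨fun t => ⟨(ShiftedBeta.bddMeasurable_density hβ t).integrable,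
    ShiftedBeta.density_nonneg_ae hβ t, ShiftedBeta.integral_density_pos hβ t, inferInstance,
    ShiftedBeta.ergodic_shiftMap hβ t, fun ν hν hac hmp => ?_⟩, fun t => ⟨?_, fun h => ?_⟩, ?_, ?_,
    fun hP _ hne => ⟨ShiftedBeta.mk_range_shiftMap hβ hne, fun s t => ?_⟩⟩
  · exact ShiftedBeta.eq_densityMeasure hβ t hac hmp
  · exact ShiftedBeta.two_le_of_density_bounds hβ t
  · obtain ⟨c, hc, hb⟩ := ShiftedBeta.exists_density_bounds hβ h
    exact ⟨c, hc, hb t⟩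
  · exact ShiftedBeta.exists_density_bounds hβ
  · exact ShiftedBeta.density_bounds hβ
  · ext x
    exact ⟨ShiftedBeta.isGenericFor_of_isGenericFor hβ hP s t,
      ShiftedBeta.isGenericFor_of_isGenericFor hβ hP t s⟩
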